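/- Let $f:(0,\infty)\to\mathbb{R}$ be strictly convex and continuously differentiable. For positive densities $\rho,\pi$ with respect to a reference measure $\mu$ write $D_f(\rho\|\pi)=\int \pi\, f(\rho/\pi)\,d\mu$. A *classical flow with target* $p$ is a family $(q_t)_{t\ge 0}$ of positive functions such that $(t,x)\mapsto q_t(x)$ is $C^1$ on $[0,\infty)\times$ space, the potential $\Phi_t:=f'(q_t/p)$ and the flux $q_t v_t$ with velocity $v_t:=-\nabla f'(q_t/p)=-\nabla\Phi_t$ are $C^1$ in $x$ for every $t\ge 0$, and the continuity equation $\partial_t q_t+\nabla\cdot(q_t v_t)=0$, that is $\partial_t q_t=\nabla\cdot(q_t\nabla\Phi_t)$, holds at every point and every $t\ge0$. (If $f,p,q$ are smooth, the regularity conditions are automatic. At $t=0$ all time derivatives are one-sided.) **(a) Euclidean space.** Let $p\in C^1(\mathbb{R}^d)$, $p>0$, and let $(q_t)_{t\ge0}$ be a classical flow with target $p$ on $\mathbb{R}^d$ with Lebesgue measure such that $\int |p\,f(q_t/p)|\,dx<\infty$ for all $t\ge 0$. Assume that the boundary terms at infinity vanish, $$\lim_{R\to\infty}\int_{\|x\|=R}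 q_t\,\Phi_t\,\nabla\Phi_t\cdot\hat n\,dS=0\qquad\text{for every } t\ge0,$$ and that the rate of change $\partial_t\bigl(p f(q_t/p)\bigr)=\Phi_t\,\partial_t q_t$ of the energy density has integrable tails, locally uniformly in time: for every $T>0$, $$\lim_{R\to\infty}\ \sup_{0\le t\le T}\int_{\|x\|\ge R}\bigl|\Phi_t\,\partial_t q_t\bigr|\,dx=0 .$$ Then for every $t\ge0$ the integral on the right below is finite and $$\frac{d}{dt}D_f(q_t\|p)=-\int q_t(x)\,\Bigl\|\nabla f'\Bigl(\frac{q_t(x)}{p(x)}\Bigr)\Bigr\|^2dx\ \le\ 0 .$$ **(b) Compact manifolds.** Let $M$ be a compact smooth Riemannian manifold without boundary, with its Riemannian volume, gradient and divergence. Let $p\in C^1(M)$, $p>0$, and let $(q_t)_{t\ge0}$ be a classical flow with target $p$ on $M$. Then, without any further condition, $D_f(q_t\|p)$ and the integral on the right below are finite for every $t\ge0$, and $$\frac{d}{dt}D_f(q_t\|p)=-\int_M q_t\,\Bigl\|\nabla f'\Bigl(\frac{q_t}{p}\Bigr)\Bigr\|^2d\mathrm{vol}\ \le\ 0 .$$ 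-/

import Mathlib

open MeasureTheory Set Filter Topology Manifold Bundle
open scoped ContDiff ENNReal RealInnerProductSpace

namespace FDivFlow

section General

variable {X : Type*}

/-- The `f`-divergence `D_f(ρ‖p) = ∫ p f(ρ/p) dμ` of two positive densities with respect to the
reference measure `μ` (Lebesgue measure, or the Riemannian volume). -/
noncomputable def fDiv [MeasurableSpace X] (μ : Measure X) (f : ℝ → ℝ) (ρ p : X → ℝ) : ℝ :=
  ∫ x, p x * f (ρ x / p x) ∂μ

/-- The potential `f'(ρ/p)`, the first variation of `D_f(·‖p)` at `ρ`. -/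
noncomputable def potential (f : ℝ → ℝ) (ρ p : X → ℝ) (x : X) : ℝ :=
  deriv f (ρ x / p x)

end General

/-! ### Euclidean space -/

section Euclidean

variable {d : ℕ}

/-- The velocity field `v_f = -∇ f'(ρ/p)` on `ℝ^d`. -/
noncomputable def velocity (f : ℝ → ℝ) (ρ p : EuclideanSpace ℝ (Fin d) → ℝ)
    (x : EuclideanSpace ℝ (Fin d)) : EuclideanSpace ℝ (Fin d) :=
  -gradient (potential f ρ p) x

/-- The divergence `∑ i, ∂_i V_i` of a vector field on `ℝ^d`. -/
noncomputable def divergence (V : EuclideanSpace ℝ (Fin d) → EuclideanSpace ℝ (Fin d))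
    (x : EuclideanSpace ℝ (Fin d)) : ℝ :=
  ∑ i, fderiv ℝ V x (EuclideanSpace.single i 1) i

/-- `q` is a classical (continuously differentiable) family of positive densities on `ℝ^d`, defined
for times `t ≥ 0`, solving the continuity equation `∂_t q_t + ∇·(q_t v_t) = 0` with velocity
`v_t = -∇ f'(q_t/p)`. The fields on the potential and on the flux say that `∇ f'(q_t/p)` and
`∇·(q_t v_t)` exist classically; both hold automatically if `f`, `p`, `q` are smooth. At `t = 0` the
time derivative is one-sided. -/
structure IsFlow (f : ℝ → ℝ) (p : EuclideanSpace ℝ (Fin d) → ℝ)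
    (q : ℝ → EuclideanSpace ℝ (Fin d) → ℝ) : Prop where
  pos : ∀ t, 0 ≤ t → ∀ x, 0 < q t x
  contDiffOn : ContDiffOn ℝ 1 (fun z : ℝ × EuclideanSpace ℝ (Fin d) ↦ q z.1 z.2)
    (Ici 0 ×ˢ univ)
  contDiff_potential : ∀ t, 0 ≤ t → ContDiff ℝ 1 (potential f (q t) p)
  contDiff_flux : ∀ t, 0 ≤ t → ContDiff ℝ 1 (fun x ↦ q t x • velocity f (q t) p x)
  continuity_eq : ∀ t, 0 ≤ t → ∀ x, HasDerivWithinAt (fun s ↦ q s x)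
    (-divergence (fun y ↦ q t y • velocity f (q t) p y) x) (Ici 0) t

/-- The integral `∫_{‖x‖ = R} F(x, n) dS(x)` over the sphere of radius `R` centred at the origin,
where `n = x / ‖x‖` is the outer unit normal at `x`; it is written over the unit sphere with its
surface measure, `x = R n` and `dS = R^(d-1) dσ(n)`. -/
noncomputable def sphereIntegral
    (F : EuclideanSpace ℝ (Fin d) → EuclideanSpace ℝ (Fin d) → ℝ) (R : ℝ) : ℝ :=
  R ^ (d - 1) * ∫ n : Metric.sphere (0 : EuclideanSpace ℝ (Fin d)) 1,
    F (R • (n : EuclideanSpace ℝ (Fin d))) n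
    ∂(volume : Measure (EuclideanSpace ℝ (Fin d))).toSphere

/-- The boundary term `∫_{‖x‖ = R} ρ f'(ρ/p) ∇f'(ρ/p) · n dS`. -/
noncomputable def boundaryTerm (f : ℝ → ℝ) (ρ p : EuclideanSpace ℝ (Fin d) → ℝ) (R : ℝ) : ℝ :=
  sphereIntegral (fun x n ↦ ρ x * potential f ρ p x * ⟪gradient (potential f ρ p) x, n⟫) R

/-- Locally uniform decay in time, in the `L¹` sense, of the tails of the rate of change
`∂_t (p f(q_t/p)) = f'(q_t/p) ∂_t q_t` of the energy density:
`sup_{0 ≤ t ≤ T} ∫_{‖x‖ ≥ R} |f'(q_t/p) ∂_t q_t| dx → 0` as `R → ∞`, for every `T`. -/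
def HasUniformTailDecay (f : ℝ → ℝ) (p : EuclideanSpace ℝ (Fin d) → ℝ)
    (q : ℝ → EuclideanSpace ℝ (Fin d) → ℝ) : Prop :=
  ∀ T : ℝ, ∀ ε : ℝ, 0 < ε → ∃ R : ℝ, ∀ t ∈ Icc 0 T,
    ∫⁻ x in {x | R ≤ ‖x‖}, ‖potential f (q t) p x * derivWithin (fun s ↦ q s x) (Ici 0) t‖ₑ
      ≤ ENNReal.ofReal ε

end Euclidean

/-! ### Riemannian manifolds without boundary -/

section Manifold

variable {n : ℕ} {M : Type*} [TopologicalSpace M] [ChartedSpace (EuclideanSpace ℝ (Fin n)) M]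

section Metric

variable [IsManifold (𝓡 n) ∞ M] [RiemannianBundle (fun x : M ↦ TangentSpace (𝓡 n) x)]

/-- The Riemannian gradient of `φ` at `x`: the tangent vector representing `dφ_x` with respect to
the inner product of the tangent space at `x`. -/
noncomputable def grad (φ : M → ℝ) (x : M) : TangentSpace (𝓡 n) x :=
  haveI : FiniteDimensional ℝ (TangentSpace (𝓡 n) x) :=
    inferInstanceAs (FiniteDimensional ℝ (EuclideanSpace ℝ (Fin n)))
  haveI : CompleteSpace (TangentSpace (𝓡 n) x) := FiniteDimensional.complete ℝ _
  (InnerProductSpace.toDual ℝ (TangentSpace (𝓡 n) x)).symm (mfderiv (𝓡 n) 𝓘(ℝ, ℝ) φ x)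

/-- The velocity field `v_f = -∇ f'(ρ/p)` on a Riemannian manifold. -/
noncomputable def riemVelocity (f : ℝ → ℝ) (ρ p : M → ℝ) (x : M) : TangentSpace (𝓡 n) x :=
  -grad (n := n) (potential f ρ p) x

/-- The coordinate vector field `∂_i` of the chart `e` at the point with coordinates `y`. -/
noncomputable def coordVec (e : OpenPartialHomeomorph M (EuclideanSpace ℝ (Fin n)))
    (y : EuclideanSpace ℝ (Fin n)) (i : Fin n) : TangentSpace (𝓡 n) (e.symm y) :=
  mfderiv (𝓡 n) (𝓡 n) e.symm y (EuclideanSpace.single i (1 : ℝ) : EuclideanSpace ℝ (Fin n))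

/-- The matrix `g_ij = ⟨∂_i, ∂_j⟩` of the metric in the chart `e`, as a function of the
coordinates. -/
noncomputable def gram (e : OpenPartialHomeomorph M (EuclideanSpace ℝ (Fin n)))
    (y : EuclideanSpace ℝ (Fin n)) : Matrix (Fin n) (Fin n) ℝ :=
  Matrix.of fun i j ↦ inner ℝ (coordVec e y i) (coordVec e y j)

/-- The volume density `√det(g_ij)` in the chart `e`. -/
noncomputable def volDensity (e : OpenPartialHomeomorph M (EuclideanSpace ℝ (Fin n)))
    (y : EuclideanSpace ℝ (Fin n)) : ℝ :=
  √(gram e y).det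

/-- The `i`-th component of the vector field `V` in the chart `e`, as a function of the
coordinates. -/
noncomputable def coordComp (e : OpenPartialHomeomorph M (EuclideanSpace ℝ (Fin n)))
    (V : ∀ x : M, TangentSpace (𝓡 n) x) (i : Fin n) (y : EuclideanSpace ℝ (Fin n)) : ℝ :=
  let w : EuclideanSpace ℝ (Fin n) := mfderiv (𝓡 n) (𝓡 n) e (e.symm y) (V (e.symm y))
  w i

/-- The Riemannian divergence of a vector field: in local coordinates,
`div V = (1 / √det g) ∑ i, ∂_i (√det g V^i)`. -/
noncomputable def riemDiv (V : ∀ x : M, TangentSpace (𝓡 n) x) (x : M) : ℝ :=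
  let e := chartAt (EuclideanSpace ℝ (Fin n)) x
  (volDensity e (e x))⁻¹ * ∑ i, fderiv ℝ (fun y ↦ volDensity e y * coordComp e V i y) (e x)
    (EuclideanSpace.single i 1)

/-- `q` is a classical (continuously differentiable) family of positive densities on the Riemannian
manifold `M`, defined for times `t ≥ 0`, solving the continuity equation
`∂_t q_t + div(q_t v_t) = 0` with velocity `v_t = -∇ f'(q_t/p)`. -/
structure IsRiemFlow (f : ℝ → ℝ) (p : M → ℝ) (q : ℝ → M → ℝ) : Prop where
  pos : ∀ t, 0 ≤ t → ∀ x, 0 < q t x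
  contMDiffOn : ContMDiffOn (𝓘(ℝ, ℝ).prod (𝓡 n)) 𝓘(ℝ, ℝ) 1
    (fun z : ℝ × M ↦ q z.1 z.2) (Ici 0 ×ˢ univ)
  contMDiff_potential : ∀ t, 0 ≤ t → ContMDiff (𝓡 n) 𝓘(ℝ, ℝ) 1 (potential f (q t) p)
  contMDiff_flux : ∀ t, 0 ≤ t → ContMDiff (𝓡 n) (𝓡 n).tangent 1
    (fun x ↦ (⟨x, q t x • riemVelocity (n := n) f (q t) p x⟩ : TangentBundle (𝓡 n) M))
  continuity_eq : ∀ t, 0 ≤ t → ∀ x, HasDerivWithinAt (fun s ↦ q s x)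
    (-riemDiv (n := n) (fun y ↦ q t y • riemVelocity (n := n) f (q t) p y) x) (Ici 0) t

/-- The Riemannian volume of the domain of the chart `e`: the image under `e⁻¹` of
`√det g dy` on the range of `e`. -/
noncomputable def chartVol [MeasurableSpace M]
    (e : OpenPartialHomeomorph M (EuclideanSpace ℝ (Fin n))) : Measure M :=
  ((volume.restrict e.target).withDensity fun y ↦ ENNReal.ofReal (volDensity e y)).map e.symm

end Metric

section Volume

variable (n M) [IsManifold (𝓡 n) ∞ M] [T2Space M] [SigmaCompactSpace M]

/-- A smooth partition of unity subordinate to the chart domains. -/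
noncomputable def chartPartition : SmoothPartitionOfUnity M (𝓡 n) M univ :=
  (SmoothPartitionOfUnity.exists_isSubordinate_chartAt_source (𝓡 n) M).choose

/-- The Riemannian volume measure, `∫ h dvol = ∑_c ∫ (χ_c h)(e_c⁻¹ y) √det g dy` for a smooth
partition of unity `(χ_c)` subordinate to the domains of the charts `e_c`. (By the change of
variables formula it does not depend on the choice of the partition.) -/
noncomputable def riemVol [MeasurableSpace M]
    [RiemannianBundle (fun x : M ↦ TangentSpace (𝓡 n) x)] : Measure M :=
  Measure.sum fun c : M ↦
    (chartVol (chartAt (EuclideanSpace ℝ (Fin n)) c)).withDensity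
      fun x ↦ ENNReal.ofReal (chartPartition n M c x)

end Volume

end Manifold

end FDivFlow

/-!
Along a flow, `p f(q_t/p)` has time derivative `Φ_t ∂_t q_t = -Φ_t div (q_t v_t)`, where
`Φ_t = f'(q_t/p)`. Integrating over space and by parts, and using `v_t = -∇Φ_t`, the derivative of
the divergence is `∫ dΦ_t(q_t v_t) = -∫ q_t ‖∇Φ_t‖²`. Both parts of the theorem need a justification
of the differentiation under the integral sign and of the integration by parts.

On `ℝ^d`, the integrals over balls are differentiated first, and the tail condition makes their
derivatives converge locally uniformly in time
(`integrable_and_hasDerivWithinAt_integral_of_tail`). For the integration by parts, `Φ` is multiplied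
by a smooth radial cutoff. In polar coordinates the term in which the derivative falls on the cutoff
is an average of the fluxes through large spheres (`tendsto_integral_fderiv_radialCutoff`), so it
tends to `0`. As the dissipation density has a sign, its integrability comes out of the limit
(`integrable_and_integral_mul_divergence`).

On a compact manifold, the time derivative is bounded on compact time intervals and the volume is
finite, so only the divergence theorem `∫ Φ div V = -∫ dΦ(V)` for `C¹` vector fields remains
(`integral_mul_riemDiv`). In one chart, for `Φ` supported in the chart domain, it is integration by
parts in coordinates (`integral_mul_chartDiv`); a partition of unity gives the general case. This
requires that the volume and the divergence do not depend on the chart. For the volume this is the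
change of variables formula, as the matrix of the metric transforms by congruence with the Jacobian
matrix (`chartVol_eq_chartVol`). For the divergence no further computation is needed: the expressions
in two charts have the same integrals against all test functions supported in both domains, by the
divergence theorem in each chart, and they are continuous (`chartDiv_eq_chartDiv`).
-/

namespace FDivFlow

/-! ### Differentiation in time on the half-line -/

/-- Differentiation under the integral sign on the half-line `[0, ∞)`, one-sided at `0`. -/
theorem hasDerivWithinAt_integral_Ici {X : Type*} [MeasurableSpace X] {μ : Measure X}
    [IsFiniteMeasure μ] {g u : ℝ → X → ℝ} (hg : ∀ t, 0 ≤ t → Integrable (g t) μ)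
    (hd : ∀ᵐ x ∂μ, ∀ t, 0 ≤ t → HasDerivWithinAt (fun s ↦ g s x) (u t x) (Ici 0) t)
    (hb : ∀ T : ℝ, ∃ C : ℝ, ∀ᵐ x ∂μ, ∀ t ∈ Icc 0 T, |u t x| ≤ C) {t : ℝ} (ht : 0 ≤ t) :
    HasDerivWithinAt (fun s ↦ ∫ x, g s x ∂μ) (∫ x, u t x ∂μ) (Ici 0) t := by
  rw [hasDerivWithinAt_iff_tendsto_slope]
  obtain ⟨C, hC⟩ := hb (t + 1)
  have hnear : ∀ᶠ s in 𝓝[Ici 0 \ {t}] t, 0 ≤ s ∧ s ≤ t + 1 := by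
    have h1 : ∀ᶠ s in 𝓝[Ici 0 \ {t}] t, s ∈ Ici (0 : ℝ) \ {t} := self_mem_nhdsWithin
    have h2 : ∀ᶠ s in 𝓝[Ici 0 \ {t}] t, s ≤ t + 1 :=
      nhdsWithin_le_nhds (eventually_le_nhds (by linarith))
    filter_upwards [h1, h2] with s hs1 hs2 using ⟨hs1.1, hs2⟩
  have key : Tendsto (fun s ↦ ∫ x, slope (fun r ↦ g r x) t s ∂μ) (𝓝[Ici 0 \ {t}] t)
      (𝓝 (∫ x, u t x ∂μ)) := by
    refine tendsto_integral_filter_of_dominated_convergence (fun _ ↦ C) ?_ ?_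
      (integrable_const _) ?_
    · filter_upwards [hnear] with s hs
      simp only [slope_def_module]
      exact (((hg s hs.1).sub (hg t ht)).smul (s - t)⁻¹).aestronglyMeasurable
    · filter_upwards [hnear] with s hs
      filter_upwards [hd, hC] with x hx hCx
      have := (convex_Icc (0 : ℝ) (t + 1)).norm_image_sub_le_of_norm_hasDerivWithin_le
        (f := fun r ↦ g r x) (f' := fun r ↦ u r x) (C := C) (x := t) (y := s)
        (fun r hr ↦ (hx r hr.1).mono Icc_subset_Ici_self) (fun r hr ↦ hCx r hr)
        ⟨ht, by linarith⟩ hs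
      rw [slope_def_module, norm_smul, norm_inv]
      rcases eq_or_ne s t with rfl | hst
      · simpa using (abs_nonneg _).trans (hCx s ⟨ht, by linarith⟩)
      · rw [inv_mul_le_iff₀ (norm_pos_iff.2 (sub_ne_zero.2 hst))]
        linarith
    · filter_upwards [hd] with x hx
      exact hasDerivWithinAt_iff_tendsto_slope.1 (hx t ht)
  refine key.congr' ?_
  filter_upwards [hnear] with s hs
  simp only [slope_def_module]
  rw [integral_smul, integral_sub (hg s hs.1) (hg t ht)]

/-- The derivative of a pointwise limit of functions on `[0, ∞)` whose derivatives form a Cauchy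
sequence uniformly on bounded intervals. -/
theorem hasDerivWithinAt_of_tendsto_of_cauchy {F : ℝ → ℝ} {Fn Gn : ℕ → ℝ → ℝ} {G t : ℝ}
    (ht : 0 ≤ t) (hF : ∀ s, 0 ≤ s → Tendsto (fun n ↦ Fn n s) atTop (𝓝 (F s)))
    (hd : ∀ n s, 0 ≤ s → HasDerivWithinAt (Fn n) (Gn n s) (Ici 0) s)
    (hC : ∀ T ε : ℝ, 0 < ε → ∃ N, ∀ m, N ≤ m → ∀ s ∈ Icc 0 T, |Gn m s - Gn N s| ≤ ε)
    (hG : Tendsto (fun n ↦ Gn n t) atTop (𝓝 G)) : HasDerivWithinAt F G (Ici 0) t := by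
  rw [hasDerivWithinAt_iff_isLittleO, Asymptotics.isLittleO_iff]
  intro c hc
  -- compare `F` with a single `Fn N`; the error splits into three parts of size `c / 3 * |s - t|`
  obtain ⟨N, hN⟩ := hC (t + 1) (c / 3) (by positivity)
  have h1 := hasDerivWithinAt_iff_isLittleO.1 (hd N t ht)
  rw [Asymptotics.isLittleO_iff] at h1
  have h2 : ∀ᶠ s in 𝓝[Ici 0] t, s ≤ t + 1 :=
    nhdsWithin_le_nhds (eventually_le_nhds (by linarith))
  have h3 : |G - Gn N t| ≤ c / 3 := by
    refine le_of_tendsto ((hG.sub_const _).abs) ?_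
    filter_upwards [eventually_ge_atTop N] with m hm using hN m hm t ⟨ht, by linarith⟩
  filter_upwards [h1 (show 0 < c / 3 by positivity), h2, self_mem_nhdsWithin] with s hs1 hs2 hs3
  have hs3 : 0 ≤ s := hs3
  have h4 : |(F s - Fn N s) - (F t - Fn N t)| ≤ c / 3 * |s - t| := by
    refine le_of_tendsto ((((hF s hs3).sub_const _).sub ((hF t ht).sub_const _)).abs) ?_
    filter_upwards [eventually_ge_atTop N] with m hm
    exact (convex_Icc (0 : ℝ) (t + 1)).norm_image_sub_le_of_norm_hasDerivWithin_le
        (f := fun r ↦ Fn m r - Fn N r) (f' := fun r ↦ Gn m r - Gn N r) (x := t) (y := s)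
        (fun r hr ↦ ((hd m r hr.1).sub (hd N r hr.1)).mono Icc_subset_Ici_self)
        (fun r hr ↦ hN m hm r hr) ⟨ht, by linarith⟩ ⟨hs3, hs2⟩
  simp only [smul_eq_mul, Real.norm_eq_abs] at hs1 ⊢
  have h5 : |(s - t) * (G - Gn N t)| ≤ c / 3 * |s - t| := by
    rw [abs_mul, mul_comm]; gcongr
  calc |F s - F t - (s - t) * G|
      = |((F s - Fn N s) - (F t - Fn N t)) + (Fn N s - Fn N t - (s - t) * Gn N t)
          - (s - t) * (G - Gn N t)| := by congr 1; ring
    _ ≤ c / 3 * |s - t| + c / 3 * |s - t| + c / 3 * |s - t| :=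
        (abs_sub _ _).trans (add_le_add ((abs_add_le _ _).trans (add_le_add h4 hs1)) h5)
    _ = c * |s - t| := by ring

theorem continuousOn_derivWithin_time {E : Type*} [NormedAddCommGroup E] [NormedSpace ℝ E]
    {U : Set E} (hU : IsOpen U) {F : ℝ × E → ℝ} (hF : ContDiffOn ℝ 1 F (Ici 0 ×ˢ U)) :
    ContinuousOn (fun z : ℝ × E ↦ derivWithin (fun s ↦ F (s, z.2)) (Ici 0) z.1)
      (Ici 0 ×ˢ U) := by
  have hun : UniqueDiffOn ℝ (Ici (0 : ℝ) ×ˢ U) := (uniqueDiffOn_Ici 0).prod hU.uniqueDiffOn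
  have h1 := hF.continuousOn_fderivWithin hun le_rfl
  refine (h1.clm_apply (continuousOn_const (c := ((1 : ℝ), (0 : E))))).congr ?_
  rintro ⟨t, x⟩ ⟨ht, hx⟩
  have hd := ((hF.differentiableOn one_ne_zero) (t, x) ⟨ht, hx⟩).hasFDerivWithinAt
  have hc : HasDerivWithinAt (fun s : ℝ ↦ (s, x)) ((1 : ℝ), (0 : E)) (Ici 0) t :=
    (hasDerivWithinAt_id t _).prodMk (hasDerivWithinAt_const t _ x)
  exact (hd.comp_hasDerivWithinAt t hc (fun s hs ↦ mk_mem_prod hs hx)).derivWithin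
    (uniqueDiffOn_Ici 0 t ht)

/-! ### Integration by parts for compactly supported functions -/

theorem integrableOn_of_continuousOn_of_eq_zero {E : Type*} [TopologicalSpace E]
    [T2Space E] [MeasurableSpace E] [BorelSpace E]
    {μ : Measure E} [IsFiniteMeasureOnCompacts μ] {U K : Set E} (hU : IsOpen U) (hK : IsCompact K)
    (hKU : K ⊆ U) {h : E → ℝ} (hc : ContinuousOn h U) (h0 : ∀ x ∈ U \ K, h x = 0) :
    IntegrableOn h U μ :=
  ((hc.mono hKU).integrableOn_compact' hK hK.measurableSet).of_forall_sdiff_eq_zero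
    hU.measurableSet h0

section Euclid

variable {E : Type*} [NormedAddCommGroup E] [NormedSpace ℝ E] [FiniteDimensional ℝ E]
  [MeasurableSpace E] [BorelSpace E] {μ : Measure E} [μ.IsAddHaarMeasure]

theorem integral_fderiv_eq_zero {h : E → ℝ} (hh : ContDiff ℝ 1 h) (hs : HasCompactSupport h)
    (v : E) : ∫ x, fderiv ℝ h x v ∂μ = 0 := by
  have h1 : Integrable (fun x ↦ fderiv ℝ h x v) μ :=
    ((hh.continuous_fderiv one_ne_zero).clm_apply continuous_const).integrable_of_hasCompactSupport
      (hs.fderiv_apply (𝕜 := ℝ) v)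
  have := integral_mul_fderiv_eq_neg_fderiv_mul_of_integrable (μ := μ) (f := fun _ : E ↦ (1 : ℝ))
    (g := h) (v := v) (by simp) (by simpa using h1)
    (by simpa using hh.continuous.integrable_of_hasCompactSupport hs)
    (fun x _ ↦ by fun_prop) (fun x _ ↦ hh.differentiable one_ne_zero x)
  simpa using this

/-- Integration by parts on an open set when one factor vanishes off a compact subset. -/
theorem setIntegral_mul_fderiv_eq_neg {U K : Set E} (hU : IsOpen U) (hK : IsCompact K)
    (hKU : K ⊆ U) {ψ a : E → ℝ} (hψ : ContDiffOn ℝ 1 ψ U) (ha : ContDiffOn ℝ 1 a U)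
    (h0 : ∀ x ∈ U \ K, ψ x = 0) (v : E) :
    IntegrableOn (fun x ↦ ψ x * fderiv ℝ a x v) U μ ∧
    IntegrableOn (fun x ↦ fderiv ℝ ψ x v * a x) U μ ∧
    ∫ x in U, ψ x * fderiv ℝ a x v ∂μ = -∫ x in U, fderiv ℝ ψ x v * a x ∂μ := by
  have hdψ : ∀ x ∈ U \ K, fderiv ℝ ψ x = 0 := fun x hx ↦ by
    have : ψ =ᶠ[𝓝 x] fun _ ↦ 0 := by
      filter_upwards [(hU.sdiff hK.isClosed).mem_nhds hx] with y hy using h0 y hy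
    rw [this.fderiv_eq]; simp
  have i1 : IntegrableOn (fun x ↦ ψ x * fderiv ℝ a x v) U μ :=
    integrableOn_of_continuousOn_of_eq_zero hU hK hKU
      (hψ.continuousOn.mul ((ha.continuousOn_fderiv_of_isOpen hU le_rfl).clm_apply
        continuousOn_const)) fun x hx ↦ by simp [h0 x hx]
  have i2 : IntegrableOn (fun x ↦ fderiv ℝ ψ x v * a x) U μ :=
    integrableOn_of_continuousOn_of_eq_zero hU hK hKU
      (((hψ.continuousOn_fderiv_of_isOpen hU le_rfl).clm_apply
        continuousOn_const).mul ha.continuousOn) fun x hx ↦ by simp [hdψ x hx]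
  refine ⟨i1, i2, ?_⟩
  -- the product, extended by zero, is `C¹` with compact support on the whole space
  set h : E → ℝ := U.indicator fun x ↦ ψ x * a x with hh
  have hz : ∀ x ∉ K, h x = 0 := fun x hx ↦ by
    by_cases hxU : x ∈ U
    · simp [hh, hxU, h0 x ⟨hxU, hx⟩]
    · simp [hh, hxU]
  have hev : ∀ x ∈ U, h =ᶠ[𝓝 x] fun x ↦ ψ x * a x := fun x hx ↦ by
    filter_upwards [hU.mem_nhds hx] with y hy using by simp [hh, hy]
  have hev' : ∀ x ∉ K, h =ᶠ[𝓝 x] fun _ ↦ 0 := fun x hx ↦ by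
    filter_upwards [hK.isClosed.isOpen_compl.mem_nhds hx] with y hy using hz y hy
  have hsm : ContDiff ℝ 1 h := by
    rw [contDiff_iff_contDiffAt]
    intro x
    by_cases hx : x ∈ K
    · have hx' := hU.mem_nhds (hKU hx)
      exact ((hψ.contDiffAt hx').mul (ha.contDiffAt hx')).congr_of_eventuallyEq (hev x (hKU hx))
    · exact contDiffAt_const.congr_of_eventuallyEq (hev' x hx)
  have hcs : HasCompactSupport h := HasCompactSupport.intro hK hz
  have hI := integral_fderiv_eq_zero (μ := μ) hsm hcs v
  rw [← setIntegral_eq_integral_of_forall_compl_eq_zero (s := U) fun x hx ↦ by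
    rw [(hev' x fun hK ↦ hx (hKU hK)).fderiv_eq]; simp] at hI
  have hE : ∀ x ∈ U, fderiv ℝ h x v = ψ x * fderiv ℝ a x v + fderiv ℝ ψ x v * a x := by
    intro x hx
    have hx' := hU.mem_nhds hx
    rw [(hev x hx).fderiv_eq, fderiv_fun_mul ((hψ.contDiffAt hx').differentiableAt one_ne_zero)
      ((ha.contDiffAt hx').differentiableAt one_ne_zero)]
    simp [mul_comm]
  rw [setIntegral_congr_fun hU.measurableSet hE, integral_add i1 i2] at hI
  linarith

end Euclid

/-! ### The energy density -/

section EnergyDensity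

variable {X : Type*} {f : ℝ → ℝ} {p : X → ℝ} {q : ℝ → X → ℝ}

theorem hasDerivWithinAt_energyDensity (hf' : ContDiffOn ℝ 1 f (Ioi 0)) {t D : ℝ} {x : X}
    (hp : 0 < p x) (hq : 0 < q t x) (h : HasDerivWithinAt (fun s ↦ q s x) D (Ici 0) t) :
    HasDerivWithinAt (fun s ↦ p x * f (q s x / p x)) (potential f (q t) p x * D) (Ici 0) t := by
  have hpos : 0 < q t x / p x := div_pos hq hp
  have h1 : HasDerivAt f (deriv f (q t x / p x)) (q t x / p x) :=
    ((hf'.differentiableOn one_ne_zero).differentiableAt (Ioi_mem_nhds hpos)).hasDerivAt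
  have h2 := (h1.comp_hasDerivWithinAt t (h.div_const (p x))).const_mul (p x)
  refine h2.congr_deriv ?_
  unfold potential
  field_simp

variable [TopologicalSpace X]

theorem continuousOn_potential (hf' : ContDiffOn ℝ 1 f (Ioi 0)) (hp : Continuous p)
    (hp0 : ∀ x, 0 < p x) (hq0 : ∀ t, 0 ≤ t → ∀ x, 0 < q t x)
    (hq : ContinuousOn (fun z : ℝ × X ↦ q z.1 z.2) (Ici 0 ×ˢ univ)) :
    ContinuousOn (fun z : ℝ × X ↦ potential f (q z.1) p z.2) (Ici 0 ×ˢ univ) :=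
  (hf'.continuousOn_deriv_of_isOpen isOpen_Ioi le_rfl).comp
    (hq.div (hp.comp continuous_snd).continuousOn fun _ _ ↦ (hp0 _).ne')
    fun _ hz ↦ div_pos (hq0 _ hz.1 _) (hp0 _)

theorem continuous_energyDensity (hf' : ContDiffOn ℝ 1 f (Ioi 0)) {ρ : X → ℝ} (hp : Continuous p)
    (hp0 : ∀ x, 0 < p x) (hρ : Continuous ρ) (hρ0 : ∀ x, 0 < ρ x) :
    Continuous fun x ↦ p x * f (ρ x / p x) :=
  hp.mul (hf'.continuousOn.comp_continuous (hρ.div hp fun x ↦ (hp0 x).ne')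
    fun x ↦ div_pos (hρ0 x) (hp0 x))

theorem continuous_slice {F : ℝ × X → ℝ} (hF : ContinuousOn F (Ici 0 ×ˢ univ)) {t : ℝ}
    (ht : 0 ≤ t) : Continuous fun x ↦ F (t, x) :=
  hF.comp_continuous (by fun_prop) fun _ ↦ ⟨ht, trivial⟩

/-- A function continuous on `[0, ∞) × X` is bounded on `[0, T] × K` for compact `K`. -/
theorem exists_bound_of_continuousOn {F : ℝ × X → ℝ} (hF : ContinuousOn F (Ici 0 ×ˢ univ))
    {K : Set X} (hK : IsCompact K) (T : ℝ) : ∃ C, ∀ x ∈ K, ∀ t ∈ Icc 0 T, |F (t, x)| ≤ C := by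
  obtain ⟨C, hC⟩ := ((isCompact_Icc (a := (0 : ℝ)) (b := T)).prod hK).exists_bound_of_continuousOn
    (hF.mono (prod_mono Icc_subset_Ici_self (subset_univ _)))
  exact ⟨C, fun x hx t ht ↦ hC (t, x) ⟨ht, hx⟩⟩

end EnergyDensity

/-! ### The divergence theorem on `ℝ^d` with vanishing flux at infinity -/

section Polar

variable {E : Type*} [NormedAddCommGroup E] [NormedSpace ℝ E] [FiniteDimensional ℝ E]
  [MeasurableSpace E] [BorelSpace E] (μ : Measure E) [μ.IsAddHaarMeasure]

/-- Integration in polar coordinates. The condition at the origin matters only in dimension `0`,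
where the origin has positive measure while the unit sphere is empty. -/
theorem integral_eq_integral_polar {h : E → ℝ} (hi : Integrable h μ) (h0 : h 0 = 0) :
    ∫ x, h x ∂μ = ∫ r in Ioi (0 : ℝ), r ^ (Module.finrank ℝ E - 1) *
      ∫ n : Metric.sphere (0 : E) 1, h (r • (n : E)) ∂μ.toSphere := by
  have hme : MeasurableSet ({0}ᶜ : Set E) := (measurableSet_singleton 0).compl
  have hmp := μ.measurePreserving_homeomorphUnitSphereProd
  have hemb := (homeomorphUnitSphereProd E).measurableEmbedding
  have hcomp : ∀ x : ({0}ᶜ : Set E), h x =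
      (fun z : Metric.sphere (0 : E) 1 × Ioi (0 : ℝ) ↦ h ((z.2 : ℝ) • (z.1 : E)))
        (homeomorphUnitSphereProd E x) := fun x ↦ by
    have hx : ‖(x : E)‖ ≠ 0 := norm_ne_zero_iff.2 x.2
    simp [smul_smul, hx]
  have hi' : Integrable (fun z : Metric.sphere (0 : E) 1 × Ioi (0 : ℝ) ↦
      h ((z.2 : ℝ) • (z.1 : E))) (μ.toSphere.prod (.volumeIoiPow (Module.finrank ℝ E - 1))) := by
    rw [← hmp.integrable_comp_emb hemb]
    have := (integrableOn_iff_comap_subtypeVal hme).1 (hi.integrableOn (s := {0}ᶜ))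
    exact this.congr (.of_forall fun x ↦ hcomp x)
  rw [← setIntegral_eq_integral_of_forall_compl_eq_zero (s := {0}ᶜ) (by simpa using h0),
    ← integral_subtype_comap hme, integral_congr_ae (.of_forall hcomp)]
  refine (hmp.integral_comp hemb (fun z : Metric.sphere (0 : E) 1 × Ioi (0 : ℝ) ↦
    h ((z.2 : ℝ) • (z.1 : E)))).trans ?_
  rw [integral_prod_symm _ hi']
  simp only [Measure.volumeIoiPow, ENNReal.ofReal]
  rw [integral_withDensity_eq_integral_smul
      (measurable_subtype_coe.pow_const _).real_toNNReal,
    integral_subtype_comap measurableSet_Ioi fun r : ℝ ↦ Real.toNNReal (r ^ _) •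
      ∫ n : Metric.sphere (0 : E) 1, h (r • (n : E)) ∂μ.toSphere]
  refine setIntegral_congr_fun measurableSet_Ioi fun r hr ↦ ?_
  rw [NNReal.smul_def, Real.coe_toNNReal _ (pow_nonneg (le_of_lt hr) _), smul_eq_mul]

end Polar

section Cutoff

/-- A smooth radial cutoff on a Euclidean space: it is `1` where `‖x‖ ^ 2 ≤ R` and `0` where
`R + 1 ≤ ‖x‖ ^ 2`. -/
noncomputable def radialCutoff {d : ℕ} (R : ℝ) (x : EuclideanSpace ℝ (Fin d)) : ℝ :=
  Real.smoothTransition (R + 1 - ‖x‖ ^ 2)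

variable {d : ℕ}

theorem contDiff_radialCutoff (R : ℝ) :
    ContDiff ℝ 1 (radialCutoff R : EuclideanSpace ℝ (Fin d) → ℝ) :=
  Real.smoothTransition.contDiff.comp (contDiff_const.sub (contDiff_norm_sq ℝ))

theorem fderiv_radialCutoff (R : ℝ) (x v : EuclideanSpace ℝ (Fin d)) :
    fderiv ℝ (radialCutoff R) x v =
      -(2 * deriv Real.smoothTransition (R + 1 - ‖x‖ ^ 2) * ⟪x, v⟫) := by
  have h1 : HasDerivAt Real.smoothTransition
      (deriv Real.smoothTransition (R + 1 - ‖x‖ ^ 2)) (R + 1 - ‖x‖ ^ 2) :=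
    ((Real.smoothTransition.contDiff (n := 1)).differentiable one_ne_zero _).hasDerivAt
  have h2 : HasFDerivAt (fun y : EuclideanSpace ℝ (Fin d) ↦ R + 1 - ‖y‖ ^ 2)
      (-(2 • (innerSL ℝ x))) x := (hasStrictFDerivAt_norm_sq x).hasFDerivAt.const_sub _
  have h3 := (h1.comp_hasFDerivAt x h2).fderiv
  rw [show radialCutoff R = Real.smoothTransition ∘ fun y : EuclideanSpace ℝ (Fin d) ↦
    R + 1 - ‖y‖ ^ 2 from rfl, h3]
  simp
  ring

theorem radialCutoff_of_le {R : ℝ} {x : EuclideanSpace ℝ (Fin d)} (hx : ‖x‖ ^ 2 ≤ R) :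
    radialCutoff R x = 1 := Real.smoothTransition.one_of_one_le (by linarith)

theorem radialCutoff_nonneg (R : ℝ) (x : EuclideanSpace ℝ (Fin d)) : 0 ≤ radialCutoff R x :=
  Real.smoothTransition.nonneg _

theorem radialCutoff_le_one (R : ℝ) (x : EuclideanSpace ℝ (Fin d)) : radialCutoff R x ≤ 1 :=
  Real.smoothTransition.le_one _

theorem hasCompactSupport_radialCutoff (R : ℝ) :
    HasCompactSupport (radialCutoff R : EuclideanSpace ℝ (Fin d) → ℝ) := by
  refine HasCompactSupport.intro (isCompact_closedBall 0 (√(R + 1))) fun x hx ↦ ?_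
  refine Real.smoothTransition.zero_of_nonpos ?_
  rw [mem_closedBall_zero_iff, not_le] at hx
  have := (Real.sqrt_lt' (lt_of_le_of_lt (Real.sqrt_nonneg _) hx)).1 hx
  linarith

theorem deriv_smoothTransition_eq_zero {s : ℝ} (hs : s ∉ Icc (0 : ℝ) 1) :
    deriv Real.smoothTransition s = 0 := by
  rw [mem_Icc, not_and_or, not_le, not_le] at hs
  rcases hs with hs | hs
  · have : Real.smoothTransition =ᶠ[𝓝 s] fun _ ↦ 0 := by
      filter_upwards [eventually_lt_nhds hs] with y hy
      exact Real.smoothTransition.zero_of_nonpos hy.le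
    rw [this.deriv_eq]; simp
  · have : Real.smoothTransition =ᶠ[𝓝 s] fun _ ↦ 1 := by
      filter_upwards [eventually_gt_nhds hs] with y hy
      exact Real.smoothTransition.one_of_one_le hy.le
    rw [this.deriv_eq]; simp

theorem exists_abs_deriv_smoothTransition_le :
    ∃ C, ∀ s, |deriv Real.smoothTransition s| ≤ C := by
  have hc : Continuous (deriv Real.smoothTransition) :=
    (Real.smoothTransition.contDiff (n := 1)).continuous_deriv le_rfl
  obtain ⟨C, hC⟩ := (isCompact_Icc (a := (0 : ℝ)) (b := 1)).exists_bound_of_continuousOn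
    hc.continuousOn
  refine ⟨C, fun s ↦ ?_⟩
  by_cases hs : s ∈ Icc (0 : ℝ) 1
  · exact hC s hs
  · rw [deriv_smoothTransition_eq_zero hs, abs_zero]
    exact (abs_nonneg _).trans (hC 0 (by simp))

end Cutoff

section Divergence

variable {d : ℕ}

/-- Integration by parts against a compactly supported function, for the divergence. -/
theorem integral_mul_divergence {φ : EuclideanSpace ℝ (Fin d) → ℝ}
    {V : EuclideanSpace ℝ (Fin d) → EuclideanSpace ℝ (Fin d)} (hφ : ContDiff ℝ 1 φ)
    (hs : HasCompactSupport φ) (hV : ContDiff ℝ 1 V) :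
    ∫ x, φ x * divergence V x = -∫ x, fderiv ℝ φ x (V x) := by
  have hVi : ∀ i, ContDiff ℝ 1 fun y ↦ V y i := fun i ↦ by fun_prop
  have key := fun i : Fin d ↦ setIntegral_mul_fderiv_eq_neg (μ := volume) isOpen_univ
    hs.isCompact (subset_univ _) hφ.contDiffOn (hVi i).contDiffOn
    (fun x hx ↦ image_eq_zero_of_notMem_tsupport hx.2) (EuclideanSpace.single i 1)
  simp only [Measure.restrict_univ, integrableOn_univ] at key
  have e1 : ∀ x, φ x * divergence V x =
      ∑ i, φ x * fderiv ℝ (fun y ↦ V y i) x (EuclideanSpace.single i 1) := fun x ↦ by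
    rw [divergence, Finset.mul_sum]
    refine Finset.sum_congr rfl fun i _ ↦ ?_
    have := ((EuclideanSpace.proj (𝕜 := ℝ) i).hasFDerivAt.comp x
      (hV.differentiable one_ne_zero x).hasFDerivAt).fderiv
    rw [show (fun y ↦ V y i) = (EuclideanSpace.proj (𝕜 := ℝ) i) ∘ V from rfl, this]
    rfl
  have e2 : ∀ x, fderiv ℝ φ x (V x) =
      ∑ i, fderiv ℝ φ x (EuclideanSpace.single i 1) * V x i := fun x ↦ by
    conv_lhs => rw [← (EuclideanSpace.basisFun (Fin d) ℝ).sum_repr (V x)]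
    simp [mul_comm]
  simp_rw [e1, e2]
  rw [integral_finsetSum _ fun i _ ↦ (key i).1, integral_finsetSum _ fun i _ ↦ (key i).2.1,
    ← Finset.sum_neg_distrib]
  exact Finset.sum_congr rfl fun i _ ↦ (key i).2.2

/-- The part of the integration by parts that falls on the cutoff sees only the fluxes through the
spheres of radius between `√R` and `√(R + 1)`; it is their average with a kernel of bounded mass. -/
theorem tendsto_integral_fderiv_radialCutoff {W : EuclideanSpace ℝ (Fin d) →
    EuclideanSpace ℝ (Fin d)} (hW : Continuous W)
    (hb : Tendsto (sphereIntegral fun x n ↦ ⟪W x, n⟫) atTop (𝓝 0)) :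
    Tendsto (fun R : ℝ ↦ ∫ x, fderiv ℝ (radialCutoff R) x (W x)) atTop (𝓝 0) := by
  obtain ⟨C, hC⟩ := exists_abs_deriv_smoothTransition_le
  have hC0 : 0 ≤ C := (abs_nonneg _).trans (hC 0)
  rw [Metric.tendsto_atTop]
  intro ε hε
  obtain ⟨r₀, hr₀⟩ := Metric.tendsto_atTop.1 hb (ε / (C + 1)) (by positivity)
  refine ⟨r₀ ^ 2, fun R hR ↦ ?_⟩
  have hR0 : 0 ≤ R := (sq_nonneg _).trans hR
  have hint : Integrable fun x ↦ fderiv ℝ (radialCutoff R) x (W x) :=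
    (((contDiff_radialCutoff R).continuous_fderiv one_ne_zero).clm_apply
      hW).integrable_of_hasCompactSupport <| by
      refine HasCompactSupport.intro (hasCompactSupport_radialCutoff (d := d) R).isCompact
        fun x hx ↦ ?_
      rw [fderiv_of_notMem_tsupport ℝ hx]; simp
  have h0 : fderiv ℝ (radialCutoff R) (0 : EuclideanSpace ℝ (Fin d)) (W 0) = 0 := by
    simp [fderiv_radialCutoff]
  have hpolar : ∫ x, fderiv ℝ (radialCutoff R) x (W x) = ∫ r in Ioi (0 : ℝ),
      -(2 * r * deriv Real.smoothTransition (R + 1 - r ^ 2)) *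
        sphereIntegral (fun x n ↦ ⟪W x, n⟫) r := by
    rw [integral_eq_integral_polar volume hint h0]
    refine setIntegral_congr_fun measurableSet_Ioi fun r hr ↦ ?_
    have hr : 0 < r := hr
    simp only [sphereIntegral, finrank_euclideanSpace_fin]
    rw [mul_left_comm, ← integral_const_mul (-_)]
    congr 1
    refine integral_congr_ae (.of_forall fun n ↦ ?_)
    have hn : ‖(n : EuclideanSpace ℝ (Fin d))‖ = 1 := by simp
    beta_reduce
    rw [fderiv_radialCutoff, norm_smul, hn, inner_smul_left, real_inner_comm]
    simp only [Real.norm_eq_abs, mul_one, sq_abs, conj_trivial]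
    ring
  have hbd : ‖∫ x, fderiv ℝ (radialCutoff R) x (W x)‖ ≤
      ∫ r in Ioi (0 : ℝ), (Icc √R √(R + 1)).indicator (fun r ↦ 2 * r * C * (ε / (C + 1))) r := by
    rw [hpolar]
    refine norm_integral_le_of_norm_le ?_ ?_
    · refine Integrable.integrableOn ((integrable_indicator_iff measurableSet_Icc).2 ?_)
      exact (by fun_prop : Continuous fun r : ℝ ↦
        2 * r * C * (ε / (C + 1))).continuousOn.integrableOn_Icc
    · filter_upwards [ae_restrict_mem measurableSet_Ioi] with r hr
      have hr : 0 < r := hr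
      by_cases hmem : r ∈ Icc √R √(R + 1)
      · rw [indicator_of_mem hmem]
        have hrr : r₀ ≤ r := (le_abs_self _).trans
          ((Real.abs_le_sqrt hR).trans hmem.1)
        have h1 := hr₀ r hrr
        rw [dist_zero_right] at h1
        rw [norm_mul, norm_neg, norm_mul, norm_mul, Real.norm_of_nonneg hr.le,
          Real.norm_of_nonneg zero_le_two]
        have := hC (R + 1 - r ^ 2)
        rw [← Real.norm_eq_abs] at this
        gcongr
      · rw [indicator_of_notMem hmem, deriv_smoothTransition_eq_zero]
        · simp
        · intro hs
          refine hmem ⟨Real.sqrt_le_iff.2 ⟨hr.le, by linarith [hs.2]⟩,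
            Real.le_sqrt_of_sq_le (by linarith [hs.1])⟩
  have hval : ∫ r in Ioi (0 : ℝ), (Icc √R √(R + 1)).indicator
      (fun r ↦ 2 * r * C * (ε / (C + 1))) r ≤ C * (ε / (C + 1)) := by
    have hle : √R ≤ √(R + 1) := Real.sqrt_le_sqrt (by linarith)
    have hnn : ∀ r : ℝ, 0 ≤ (Icc √R √(R + 1)).indicator
        (fun r ↦ 2 * r * C * (ε / (C + 1))) r := fun r ↦ by
      refine indicator_nonneg (fun r hr ↦ ?_) r
      have : 0 ≤ r := (Real.sqrt_nonneg _).trans hr.1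
      positivity
    refine (setIntegral_le_integral ((integrable_indicator_iff measurableSet_Icc).2
      (by fun_prop : Continuous fun r : ℝ ↦
        2 * r * C * (ε / (C + 1))).continuousOn.integrableOn_Icc)
      (.of_forall hnn)).trans ?_
    rw [integral_indicator measurableSet_Icc, integral_Icc_eq_integral_Ioc,
      ← intervalIntegral.integral_of_le hle]
    have : ∀ r : ℝ, 2 * r * C * (ε / (C + 1)) = (2 * C * (ε / (C + 1))) * r := fun r ↦ by ring
    simp_rw [this]
    rw [intervalIntegral.integral_const_mul, integral_id, Real.sq_sqrt (by linarith),
      Real.sq_sqrt hR0]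
    apply le_of_eq; ring
  rw [dist_zero_right]
  refine (hbd.trans hval).trans_lt ?_
  rw [← mul_div_assoc, div_lt_iff₀ (by linarith)]
  nlinarith

/-- Divergence theorem on `ℝ^d`: if the flux of `Φ V` through large spheres vanishes in the limit,
`Φ div V` is integrable and `dΦ(V) ≤ 0`, then `dΦ(V)` is integrable as well and
`∫ Φ div V = -∫ dΦ(V)`. -/
theorem integrable_and_integral_mul_divergence {Φ : EuclideanSpace ℝ (Fin d) → ℝ}
    {V : EuclideanSpace ℝ (Fin d) → EuclideanSpace ℝ (Fin d)} (hΦ : ContDiff ℝ 1 Φ)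
    (hV : ContDiff ℝ 1 V) (hi : Integrable fun x ↦ Φ x * divergence V x)
    (hneg : ∀ x, fderiv ℝ Φ x (V x) ≤ 0)
    (hb : Tendsto (sphereIntegral fun x n ↦ ⟪Φ x • V x, n⟫) atTop (𝓝 0)) :
    Integrable (fun x ↦ fderiv ℝ Φ x (V x)) ∧
      ∫ x, Φ x * divergence V x = -∫ x, fderiv ℝ Φ x (V x) := by
  set g : EuclideanSpace ℝ (Fin d) → ℝ := fun x ↦ -fderiv ℝ Φ x (V x) with hg
  have hgc : Continuous g := ((hΦ.continuous_fderiv one_ne_zero).clm_apply hV.continuous).neg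
  have hg0 : ∀ x, 0 ≤ g x := fun x ↦ by simpa [hg] using hneg x
  have hηg : ∀ R, Integrable fun x ↦ radialCutoff R x * g x := fun R ↦
    ((contDiff_radialCutoff R).continuous.mul hgc).integrable_of_hasCompactSupport
      (hasCompactSupport_radialCutoff R).mul_right
  -- integration by parts against the compactly supported function `radialCutoff R * Φ`
  have hid : ∀ R, ∫ x, radialCutoff R x * g x = (∫ x, radialCutoff R x * (Φ x * divergence V x)) +
      ∫ x, fderiv ℝ (radialCutoff R) x (Φ x • V x) := fun R ↦ by
    have hη := contDiff_radialCutoff (d := d) R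
    have h1 := integral_mul_divergence (hη.mul hΦ) (hasCompactSupport_radialCutoff R).mul_right hV
    have h2 : ∀ x, fderiv ℝ (fun y ↦ radialCutoff R y * Φ y) x (V x) =
        fderiv ℝ (radialCutoff R) x (Φ x • V x) - radialCutoff R x * g x := fun x ↦ by
      rw [fderiv_fun_mul (hη.differentiable one_ne_zero x) (hΦ.differentiable one_ne_zero x)]
      simp [hg]; ring
    have h3 : Integrable fun x ↦ fderiv ℝ (radialCutoff R) x (Φ x • V x) :=
      ((hη.continuous_fderiv one_ne_zero).clm_apply
        (hΦ.continuous.smul hV.continuous)).integrable_of_hasCompactSupport <| by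
      refine HasCompactSupport.intro (hasCompactSupport_radialCutoff (d := d) R).isCompact
        fun x hx ↦ ?_
      rw [fderiv_of_notMem_tsupport ℝ hx]; simp
    simp_rw [h2] at h1
    rw [integral_sub h3 (hηg R)] at h1
    simp_rw [mul_assoc] at h1
    linarith
  have hlim1 : ∀ x : EuclideanSpace ℝ (Fin d), ∀ᶠ R : ℝ in atTop, radialCutoff R x = 1 :=
    fun x ↦ by
      filter_upwards [eventually_ge_atTop (‖x‖ ^ 2)] with R hR using radialCutoff_of_le hR
  have habs : ∀ R (x : EuclideanSpace ℝ (Fin d)) (a : ℝ), ‖radialCutoff R x * a‖ ≤ ‖a‖ :=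
    fun R x a ↦ by
      rw [norm_mul, Real.norm_of_nonneg (radialCutoff_nonneg R x)]
      exact mul_le_of_le_one_left (norm_nonneg _) (radialCutoff_le_one R x)
  have hlim : ∀ {h : EuclideanSpace ℝ (Fin d) → ℝ}, Integrable h →
      Tendsto (fun R : ℝ ↦ ∫ x, radialCutoff R x * h x) atTop (𝓝 (∫ x, h x)) := fun {h} hh ↦ by
    refine tendsto_integral_filter_of_dominated_convergence (fun x ↦ ‖h x‖)
      (.of_forall fun R ↦ (contDiff_radialCutoff R).continuous.aestronglyMeasurable.mul hh.1)
      (.of_forall fun R ↦ .of_forall fun x ↦ habs R x _) hh.norm (.of_forall fun x ↦ ?_)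
    refine tendsto_const_nhds.congr' ?_
    filter_upwards [hlim1 x] with R hR
    rw [hR, one_mul]
  have hL : Tendsto (fun R : ℝ ↦ ∫ x, radialCutoff R x * g x) atTop
      (𝓝 (∫ x, Φ x * divergence V x)) := by
    simp_rw [hid]
    simpa using (hlim hi).add
      (tendsto_integral_fderiv_radialCutoff (hΦ.continuous.smul hV.continuous) hb)
  -- `g` is nonnegative, so the limit `hL` bounds its integrals over balls
  have hgi : Integrable g := by
    refine AECover.integrable_of_integral_bounded_of_nonneg_ae (l := atTop)
      (aecover_closedBall (x := 0) (r := fun R : ℝ ↦ √R) Real.tendsto_sqrt_atTop)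
      ((∫ x, Φ x * divergence V x) + 1)
      (fun R ↦ hgc.continuousOn.integrableOn_compact (isCompact_closedBall _ _))
      (.of_forall hg0) ?_
    filter_upwards [hL.eventually_le_const (lt_add_one _), eventually_ge_atTop 0] with R hR hR0
    refine le_trans ?_ hR
    have : ∫ x in Metric.closedBall (0 : EuclideanSpace ℝ (Fin d)) √R, g x =
        ∫ x in Metric.closedBall (0 : EuclideanSpace ℝ (Fin d)) √R, radialCutoff R x * g x := by
      refine setIntegral_congr_fun measurableSet_closedBall fun x hx ↦ ?_
      rw [mem_closedBall_zero_iff] at hx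
      rw [radialCutoff_of_le ((Real.le_sqrt (norm_nonneg _) hR0).1 hx), one_mul]
    rw [this]
    exact setIntegral_le_integral (hηg R)
      (.of_forall fun x ↦ mul_nonneg (radialCutoff_nonneg R x) (hg0 x))
  have hfin : ∫ x, Φ x * divergence V x = ∫ x, g x := tendsto_nhds_unique hL (hlim hgi)
  refine ⟨by simpa [hg] using hgi.neg, ?_⟩
  rw [hfin, integral_neg]

end Divergence

/-! ### Energy dissipation on `ℝ^d` -/

section EuclideanFlow

variable {d : ℕ} {f : ℝ → ℝ} {p : EuclideanSpace ℝ (Fin d) → ℝ}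
  {q : ℝ → EuclideanSpace ℝ (Fin d) → ℝ}

/-- If the rate of change `u` of a density `g` on `ℝ^d` has locally uniformly integrable tails, then
`u t` is integrable and the integral of `g` may be differentiated under the integral sign: the
integrals over balls have derivatives that converge locally uniformly in time. -/
theorem integrable_and_hasDerivWithinAt_integral_of_tail {g u : ℝ → EuclideanSpace ℝ (Fin d) → ℝ}
    (hg : ∀ t, 0 ≤ t → Integrable (g t))
    (hd : ∀ t, 0 ≤ t → ∀ x, HasDerivWithinAt (fun s ↦ g s x) (u t x) (Ici 0) t)
    (hu : ContinuousOn (fun z : ℝ × EuclideanSpace ℝ (Fin d) ↦ u z.1 z.2) (Ici 0 ×ˢ univ))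
    (htail : ∀ T ε : ℝ, 0 < ε → ∃ R : ℝ, ∀ t ∈ Icc 0 T,
      ∫⁻ x in {x | R ≤ ‖x‖}, ‖u t x‖ₑ ≤ ENNReal.ofReal ε) {t : ℝ} (ht : 0 ≤ t) :
    Integrable (u t) ∧
      HasDerivWithinAt (fun s ↦ ∫ x, g s x) (∫ x, u t x) (Ici 0) t := by
  have huc : ∀ s, 0 ≤ s → Continuous (u s) := fun s hs ↦ continuous_slice hu hs
  have hcover : AECover (volume : Measure (EuclideanSpace ℝ (Fin d))) atTop
      fun n : ℕ ↦ Metric.closedBall (0 : EuclideanSpace ℝ (Fin d)) n :=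
    aecover_closedBall tendsto_natCast_atTop_atTop
  have hui : Integrable (u t) := by
    obtain ⟨R, hR⟩ := htail t 1 one_pos
    have h1 : IntegrableOn (u t) {x | R ≤ ‖x‖} :=
      ⟨(huc t ht).aestronglyMeasurable, (hR t ⟨ht, le_rfl⟩).trans_lt ENNReal.ofReal_lt_top⟩
    have h2 : IntegrableOn (u t) (Metric.closedBall 0 R) :=
      (huc t ht).continuousOn.integrableOn_compact (isCompact_closedBall _ _)
    rw [← integrableOn_univ]
    refine (h1.union h2).mono_set fun x _ ↦ ?_
    rcases le_total R ‖x‖ with h | h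
    · exact Or.inl h
    · exact Or.inr (by simpa using h)
  refine ⟨hui, hasDerivWithinAt_of_tendsto_of_cauchy
    (Fn := fun n s ↦ ∫ x in Metric.closedBall 0 n, g s x)
    (Gn := fun n s ↦ ∫ x in Metric.closedBall 0 n, u s x) ht
    (fun s hs ↦ hcover.integral_tendsto_of_countably_generated (hg s hs)) (fun n s hs ↦ ?_)
    (fun T ε hε ↦ ?_) (hcover.integral_tendsto_of_countably_generated hui)⟩
  · have : IsFiniteMeasure ((volume : Measure (EuclideanSpace ℝ (Fin d))).restrict
        (Metric.closedBall 0 n)) :=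
      ⟨by rw [Measure.restrict_apply_univ]; exact measure_closedBall_lt_top⟩
    refine hasDerivWithinAt_integral_Ici (fun r hr ↦ (hg r hr).integrableOn)
      (.of_forall fun x r hr ↦ hd r hr x) (fun T ↦ ?_) hs
    obtain ⟨C, hC⟩ := exists_bound_of_continuousOn hu
      (isCompact_closedBall (0 : EuclideanSpace ℝ (Fin d)) n) T
    exact ⟨C, by filter_upwards [ae_restrict_mem measurableSet_closedBall] with x hx using hC x hx⟩
  · obtain ⟨R, hR⟩ := htail T ε hε
    obtain ⟨N, hN⟩ := exists_nat_gt R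
    refine ⟨N, fun m hm s hs ↦ ?_⟩
    have hsub : Metric.closedBall (0 : EuclideanSpace ℝ (Fin d)) N ⊆ Metric.closedBall 0 m :=
      Metric.closedBall_subset_closedBall (by exact_mod_cast hm)
    have hi : IntegrableOn (u s) (Metric.closedBall 0 m) :=
      (huc s hs.1).continuousOn.integrableOn_compact (isCompact_closedBall _ _)
    rw [← setIntegral_sdiff measurableSet_closedBall hi hsub,
      ← ENNReal.ofReal_le_ofReal_iff hε.le, ← Real.enorm_eq_ofReal_abs]
    refine (enorm_integral_le_lintegral_enorm _).trans ((lintegral_mono_set ?_).trans (hR s hs))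
    rintro x ⟨-, hx⟩
    rw [mem_closedBall_zero_iff, not_le] at hx
    exact (hN.trans hx).le

/-- Energy dissipation along a classical flow on `ℝ^d`. -/
theorem IsFlow.hasDerivWithinAt_fDiv (hf' : ContDiffOn ℝ 1 f (Ioi 0)) (hp : ContDiff ℝ 1 p)
    (hp0 : ∀ x, 0 < p x) (hq : IsFlow f p q)
    (hint : ∀ t, 0 ≤ t → Integrable (fun x ↦ p x * f (q t x / p x)))
    (htail : HasUniformTailDecay f p q) {t : ℝ} (ht : 0 ≤ t)
    (hbd : Tendsto (boundaryTerm f (q t) p) atTop (𝓝 0)) :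
    Integrable (fun x ↦ q t x * ‖gradient (potential f (q t) p) x‖ ^ 2) ∧
      HasDerivWithinAt (fun s ↦ fDiv volume f (q s) p)
        (-∫ x, q t x * ‖gradient (potential f (q t) p) x‖ ^ 2) (Ici 0) t := by
  set Φ := potential f (q t) p with hΦ
  set V : EuclideanSpace ℝ (Fin d) → EuclideanSpace ℝ (Fin d) :=
    fun x ↦ q t x • velocity f (q t) p x with hV
  have hcont : ContDiffOn ℝ 1 (fun z : ℝ × EuclideanSpace ℝ (Fin d) ↦ q z.1 z.2)
    (Ici 0 ×ˢ univ) := hq.contDiffOn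
  have hder : ∀ s, 0 ≤ s → ∀ x, HasDerivWithinAt (fun r ↦ q r x)
      (derivWithin (fun r ↦ q r x) (Ici 0) s) (Ici 0) s := fun s hs x ↦
    (hq.continuity_eq s hs x).differentiableWithinAt.hasDerivWithinAt
  obtain ⟨hui, hE⟩ := integrable_and_hasDerivWithinAt_integral_of_tail
    (u := fun s x ↦ potential f (q s) p x * derivWithin (fun r ↦ q r x) (Ici 0) s) hint
    (fun s hs x ↦ hasDerivWithinAt_energyDensity hf' (hp0 x) (hq.pos s hs x) (hder s hs x))
    ((continuousOn_potential hf' hp.continuous hp0 hq.pos hcont.continuousOn).mul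
      (continuousOn_derivWithin_time isOpen_univ hcont)) htail ht
  have hu : ∀ x, potential f (q t) p x * derivWithin (fun r ↦ q r x) (Ici 0) t =
      -(Φ x * divergence V x) := fun x ↦ by
    rw [(hq.continuity_eq t ht x).derivWithin (uniqueDiffOn_Ici 0 t ht), mul_neg]
  -- the velocity is `-∇Φ`, so `V` descends along `Φ` at the rate of dissipation
  have hdis : ∀ x, fderiv ℝ Φ x (V x) = -(q t x * ‖gradient Φ x‖ ^ 2) := fun x ↦ by
    rw [← toDual_gradient, InnerProductSpace.toDual_apply_apply,
      show V x = q t x • -gradient Φ x from rfl, inner_smul_right,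
      inner_neg_right, real_inner_self_eq_norm_sq, mul_neg]
  have hflux : sphereIntegral (fun x n ↦ ⟪Φ x • V x, n⟫) = fun R ↦ -boundaryTerm f (q t) p R := by
    funext R
    rw [boundaryTerm, sphereIntegral, sphereIntegral, ← mul_neg, ← integral_neg]
    congr 2
    funext n
    simp only [hV, velocity, ← hΦ, inner_smul_left, inner_neg_left, conj_trivial]
    ring
  simp_rw [hu] at hui hE
  obtain ⟨h1, h2⟩ := integrable_and_integral_mul_divergence (Φ := Φ) (V := V)
    (hq.contDiff_potential t ht)
    (hq.contDiff_flux t ht) (by simpa using hui.neg)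
    (fun x ↦ by
      rw [hdis, neg_nonpos]
      exact mul_nonneg (hq.pos t ht x).le (sq_nonneg _))
    (by
      rw [hflux]
      simpa using hbd.neg)
  simp_rw [hdis] at h1 h2
  rw [integral_neg, neg_neg] at h2
  rw [integral_neg, h2] at hE
  exact ⟨by simpa using h1.neg, hE⟩

end EuclideanFlow

/-! ### The metric in the charts of a Riemannian manifold -/

section Charts

variable {n : ℕ} {M : Type*} [TopologicalSpace M] [ChartedSpace (EuclideanSpace ℝ (Fin n)) M]
  [IsManifold (𝓡 n) ∞ M]

/-- In the trivialization of the tangent bundle given by the chart at `c`, a tangent vector is read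
through the derivative of that chart. -/
theorem trivializationAt_snd {c x : M} (hx : x ∈ (chartAt (EuclideanSpace ℝ (Fin n)) c).source)
    (v : TangentSpace (𝓡 n) x) :
    (trivializationAt (EuclideanSpace ℝ (Fin n)) (TangentSpace (𝓡 n)) c ⟨x, v⟩).2 =
      mfderiv (𝓡 n) (𝓡 n) (chartAt (EuclideanSpace ℝ (Fin n)) c) x v := by
  rw [← Trivialization.continuousLinearMapAt_apply_of_mem (R := ℝ) _ (by simpa using hx),
    TangentBundle.continuousLinearMapAt_trivializationAt hx, (hasMFDerivAt_extChartAt hx).mfderiv]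
  rfl

theorem contMDiffOn_section_iff_chart {k : ℕ∞} (c : M) {V : ∀ x : M, TangentSpace (𝓡 n) x} :
    ContMDiffOn (𝓡 n) (𝓡 n).tangent k (fun x ↦ (⟨x, V x⟩ : TangentBundle (𝓡 n) M))
      (chartAt (EuclideanSpace ℝ (Fin n)) c).source ↔
    ContMDiffOn (𝓡 n) (𝓡 n) k (fun x ↦ (mfderiv (𝓡 n) (𝓡 n)
      (chartAt (EuclideanSpace ℝ (Fin n)) c) x (V x) : EuclideanSpace ℝ (Fin n)))
      (chartAt (EuclideanSpace ℝ (Fin n)) c).source := by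
  have : IsManifold (𝓡 n) (k + 1) M := .of_le (n := ∞) (by exact_mod_cast le_top)
  have := TangentBundle.contMDiffVectorBundle (n := k) (I := 𝓡 n) (M := M)
  have h := (trivializationAt (EuclideanSpace ℝ (Fin n)) (TangentSpace (𝓡 n))
    c).contMDiffOn_section_baseSet_iff (n := k) (IB := 𝓡 n) (s := V)
  rw [TangentBundle.trivializationAt_baseSet] at h
  refine h.trans (contMDiffOn_congr fun x hx ↦ ?_)
  rw [trivializationAt_snd hx]

variable (n) in
/-- The inner product of the tangent space at `x`, on vectors of the model space, to which the
tangent space is definitionally equal, so that the base point can be rewritten. -/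
noncomputable def metricForm [RiemannianBundle (fun x : M ↦ TangentSpace (𝓡 n) x)] (x : M)
    (v w : EuclideanSpace ℝ (Fin n)) : ℝ :=
  @inner ℝ (TangentSpace (𝓡 n) x) _ v w

variable (n) in
/-- The derivative at `y` of the inverse of the chart `e`, as a linear endomorphism of the model
space; it sends the standard basis to the coordinate vectors. -/
noncomputable def frame (e : OpenPartialHomeomorph M (EuclideanSpace ℝ (Fin n)))
    (y : EuclideanSpace ℝ (Fin n)) : EuclideanSpace ℝ (Fin n) →L[ℝ] EuclideanSpace ℝ (Fin n) :=
  mfderiv (𝓡 n) (𝓡 n) e.symm y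

variable (n) in
/-- The derivative at `x` of the chart `e`, as a linear endomorphism of the model space. -/
noncomputable def coframe (e : OpenPartialHomeomorph M (EuclideanSpace ℝ (Fin n)))
    (x : M) : EuclideanSpace ℝ (Fin n) →L[ℝ] EuclideanSpace ℝ (Fin n) :=
  mfderiv (𝓡 n) (𝓡 n) e x

section Atlas

variable {e e' : OpenPartialHomeomorph M (EuclideanSpace ℝ (Fin n))}

theorem frame_coframe (he : e ∈ atlas (EuclideanSpace ℝ (Fin n)) M) {x : M} (hx : x ∈ e.source)
    (v : EuclideanSpace ℝ (Fin n)) : frame n e (e x) (coframe n e x v) = v :=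
  DFunLike.congr_fun ((mdifferentiable_of_mem_atlas (I := 𝓡 n) he).symm_comp_deriv hx) v

theorem coframe_frame (he : e ∈ atlas (EuclideanSpace ℝ (Fin n)) M)
    {y : EuclideanSpace ℝ (Fin n)} (hy : y ∈ e.target)
    (v : EuclideanSpace ℝ (Fin n)) : coframe n e (e.symm y) (frame n e y v) = v :=
  DFunLike.congr_fun ((mdifferentiable_of_mem_atlas (I := 𝓡 n) he).comp_symm_deriv hy) v

theorem hasFDerivAt_transition (he : e ∈ atlas (EuclideanSpace ℝ (Fin n)) M)
    (he' : e' ∈ atlas (EuclideanSpace ℝ (Fin n)) M) {y : EuclideanSpace ℝ (Fin n)}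
    (hy : y ∈ e.target) (hy' : e.symm y ∈ e'.source) :
    HasFDerivAt (fun z ↦ e' (e.symm z)) ((coframe n e' (e.symm y)).comp (frame n e y)) y := by
  have h1 := (mdifferentiableAt_atlas (I := 𝓡 n) he' hy').hasMFDerivAt
  have h2 := (mdifferentiableAt_atlas_symm (I := 𝓡 n) he hy).hasMFDerivAt
  exact (h1.comp y h2).hasFDerivAt

variable [RiemannianBundle (fun x : M ↦ TangentSpace (𝓡 n) x)]

omit [IsManifold (𝓡 n) ∞ M] in
theorem metricForm_sum (x : M) {ι : Type*} (s : Finset ι) (a : ι → ℝ)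
    (v : ι → EuclideanSpace ℝ (Fin n)) (w : EuclideanSpace ℝ (Fin n)) :
    metricForm n x (∑ i ∈ s, a i • v i) w = ∑ i ∈ s, a i * metricForm n x (v i) w := by
  let L : EuclideanSpace ℝ (Fin n) →ₗ[ℝ] ℝ :=
    { toFun := fun v ↦ metricForm n x v w
      map_add' := fun v v' ↦ inner_add_left (E := TangentSpace (𝓡 n) x) v v' w
      map_smul' := fun r v ↦ real_inner_smul_left (F := TangentSpace (𝓡 n) x) v w r }
  change L _ = ∑ i ∈ s, a i * L (v i)
  simp

omit [IsManifold (𝓡 n) ∞ M] in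
theorem metricForm_comm (x : M) (v w : EuclideanSpace ℝ (Fin n)) :
    metricForm n x v w = metricForm n x w v :=
  real_inner_comm (F := TangentSpace (𝓡 n) x) _ _

omit [IsManifold (𝓡 n) ∞ M] in
theorem metricForm_sum_sum (x : M) {ι : Type*} (s : Finset ι) (a b : ι → ℝ)
    (v : ι → EuclideanSpace ℝ (Fin n)) :
    metricForm n x (∑ i ∈ s, a i • v i) (∑ i ∈ s, b i • v i) =
      ∑ i ∈ s, ∑ j ∈ s, a i * metricForm n x (v i) (v j) * b j := by
  rw [metricForm_sum]
  refine Finset.sum_congr rfl fun i _ ↦ ?_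
  rw [metricForm_comm, metricForm_sum, Finset.mul_sum]
  refine Finset.sum_congr rfl fun j _ ↦ ?_
  rw [metricForm_comm]
  ring

theorem gram_posDef (he : e ∈ atlas (EuclideanSpace ℝ (Fin n)) M)
    {y : EuclideanSpace ℝ (Fin n)} (hy : y ∈ e.target) : (gram e y).PosDef := by
  have hinj : Function.Injective (frame n e y) :=
    Function.LeftInverse.injective (g := coframe n e (e.symm y)) (coframe_frame he hy)
  have hli : LinearIndependent ℝ fun i ↦ frame n e y (EuclideanSpace.single i 1) := by
    have h := (EuclideanSpace.basisFun (Fin n) ℝ).toBasis.linearIndependent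
    have := h.map' (frame n e y : EuclideanSpace ℝ (Fin n) →ₗ[ℝ] EuclideanSpace ℝ (Fin n))
      (LinearMap.ker_eq_bot.2 hinj)
    simpa [Function.comp_def] using this
  exact Matrix.posDef_gram_of_linearIndependent (E := TangentSpace (𝓡 n) (e.symm y))
    (v := fun i ↦ coordVec e y i) hli

theorem volDensity_pos (he : e ∈ atlas (EuclideanSpace ℝ (Fin n)) M)
    {y : EuclideanSpace ℝ (Fin n)} (hy : y ∈ e.target) : 0 < volDensity e y :=
  Real.sqrt_pos.2 (gram_posDef he hy).det_pos

/-- The matrix of the metric transforms by congruence with the Jacobian matrix of the transition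
map, hence the volume density by the absolute value of the Jacobian determinant. -/
theorem volDensity_transition (he' : e' ∈ atlas (EuclideanSpace ℝ (Fin n)) M)
    {y : EuclideanSpace ℝ (Fin n)} (hy' : e.symm y ∈ e'.source) :
    volDensity e y =
      |((coframe n e' (e.symm y)).comp (frame n e y)).det| * volDensity e' (e' (e.symm y)) := by
  set A := (coframe n e' (e.symm y)).comp (frame n e y) with hA
  set b := (EuclideanSpace.basisFun (Fin n) ℝ).toBasis with hb
  set J := LinearMap.toMatrix b b (A : EuclideanSpace ℝ (Fin n) →ₗ[ℝ] EuclideanSpace ℝ (Fin n))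
    with hJ
  have hJe : ∀ k i, J k i = A (EuclideanSpace.single i 1) k := fun k i ↦ by
    simp [hJ, hb, LinearMap.toMatrix_apply]
  have hexp : ∀ i, frame n e y (EuclideanSpace.single i 1) =
      ∑ k, J k i • frame n e' (e' (e.symm y)) (EuclideanSpace.single k 1) := fun i ↦ by
    have h1 : frame n e' (e' (e.symm y)) (A (EuclideanSpace.single i 1)) =
        frame n e y (EuclideanSpace.single i 1) := frame_coframe he' hy' _
    rw [← h1]
    conv_lhs => rw [← (EuclideanSpace.basisFun (Fin n) ℝ).sum_repr (A (EuclideanSpace.single i 1))]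
    simp [hJe]
  have hbase : e'.symm (e' (e.symm y)) = e.symm y := e'.left_inv hy'
  have hgram : gram e y = J.transpose * gram e' (e' (e.symm y)) * J := by
    ext i j
    have h1 : gram e y i j = metricForm n (e.symm y) (frame n e y (EuclideanSpace.single i 1))
      (frame n e y (EuclideanSpace.single j 1)) := rfl
    have h2 : ∀ k l, gram e' (e' (e.symm y)) k l = metricForm n
        (e'.symm (e' (e.symm y)))
        (frame n e' (e' (e.symm y)) (EuclideanSpace.single k 1))
        (frame n e' (e' (e.symm y)) (EuclideanSpace.single l 1)) := fun k l ↦ rfl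
    rw [hbase] at h2
    rw [h1, hexp, hexp, metricForm_sum_sum]
    simp only [Matrix.mul_apply, Matrix.transpose_apply, h2, Finset.sum_mul]
    rw [Finset.sum_comm]
  have hdet : J.det = A.det := LinearMap.det_toMatrix b _
  rw [volDensity, volDensity, hgram, Matrix.det_mul, Matrix.det_mul, Matrix.det_transpose, hdet,
    mul_comm, ← mul_assoc, Real.sqrt_mul (mul_self_nonneg _), Real.sqrt_mul_self_eq_abs]

end Atlas

section Smooth

variable [RiemannianBundle (fun x : M ↦ TangentSpace (𝓡 n) x)]

theorem contDiffOn_gram [IsContMDiffRiemannianBundle (𝓡 n) ∞ (EuclideanSpace ℝ (Fin n))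
    (fun x : M ↦ TangentSpace (𝓡 n) x)] (c : M) (i j : Fin n) :
    ContDiffOn ℝ ∞ (fun y ↦ gram (chartAt (EuclideanSpace ℝ (Fin n)) c) y i j)
      (chartAt (EuclideanSpace ℝ (Fin n)) c).target := by
  set e := chartAt (EuclideanSpace ℝ (Fin n)) c with he
  have hat : e ∈ atlas (EuclideanSpace ℝ (Fin n)) M := chart_mem_atlas _ c
  have hsec : ∀ k : Fin n, ContMDiffOn (𝓡 n) (𝓡 n).tangent ∞
      (fun x ↦ (⟨x, frame n e (e x) (EuclideanSpace.single k 1)⟩ : TangentBundle (𝓡 n) M))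
      e.source := fun k ↦ by
    refine (contMDiffOn_section_iff_chart (k := ⊤) c).2 ?_
    refine (contMDiffOn_const (c := EuclideanSpace.single k 1)).congr fun x hx ↦ ?_
    have := coframe_frame hat (e.map_source hx) (EuclideanSpace.single k 1)
    rwa [e.left_inv hx] at this
  have hinner := ContMDiffOn.inner_bundle (hsec i) (hsec j)
  rw [← contMDiffOn_iff_contDiffOn]
  refine (hinner.comp (contMDiffOn_chart_symm (x := c)) fun y hy ↦ e.map_target hy).congr
    fun y hy ↦ ?_
  change _ = metricForm n (e.symm y) (frame n e (e (e.symm y)) _) (frame n e (e (e.symm y)) _)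
  rw [e.right_inv hy]
  rfl

theorem contDiffOn_volDensity [IsContMDiffRiemannianBundle (𝓡 n) ∞ (EuclideanSpace ℝ (Fin n))
    (fun x : M ↦ TangentSpace (𝓡 n) x)] (c : M) :
    ContDiffOn ℝ ∞ (volDensity (chartAt (EuclideanSpace ℝ (Fin n)) c))
      (chartAt (EuclideanSpace ℝ (Fin n)) c).target := by
  refine ContDiffOn.sqrt ?_ fun y hy ↦ (gram_posDef (chart_mem_atlas _ c) hy).det_pos.ne'
  simp only [Matrix.det_apply']
  exact ContDiffOn.sum fun σ _ ↦ contDiffOn_const.mul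
    (contDiffOn_prod fun i _ ↦ contDiffOn_gram c _ _)

omit [RiemannianBundle (fun x : M ↦ TangentSpace (𝓡 n) x)] in
theorem contDiffOn_coordComp {V : ∀ x : M, TangentSpace (𝓡 n) x}
    (hV : ContMDiff (𝓡 n) (𝓡 n).tangent 1 (fun x ↦ (⟨x, V x⟩ : TangentBundle (𝓡 n) M)))
    (c : M) (i : Fin n) :
    ContDiffOn ℝ 1 (coordComp (chartAt (EuclideanSpace ℝ (Fin n)) c) V i)
      (chartAt (EuclideanSpace ℝ (Fin n)) c).target := by
  have h1 := (contMDiffOn_section_iff_chart (k := 1) c (V := V)).1 hV.contMDiffOn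
  have h2 := h1.comp (contMDiffOn_chart_symm (x := c))
    fun y hy ↦ (chartAt (EuclideanSpace ℝ (Fin n)) c).map_target hy
  rw [contMDiffOn_iff_contDiffOn] at h2
  exact (EuclideanSpace.proj (𝕜 := ℝ) i).contDiff.comp_contDiffOn h2

end Smooth

end Charts

/-! ### The Riemannian volume -/

section Volume

variable {n : ℕ} {M : Type*} [TopologicalSpace M] [ChartedSpace (EuclideanSpace ℝ (Fin n)) M]
  [IsManifold (𝓡 n) ∞ M] [RiemannianBundle (fun x : M ↦ TangentSpace (𝓡 n) x)]
  [MeasurableSpace M] [BorelSpace M]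

section Atlas

variable {e e' : OpenPartialHomeomorph M (EuclideanSpace ℝ (Fin n))}

omit [ChartedSpace (EuclideanSpace ℝ (Fin n)) M] [IsManifold (𝓡 n) ∞ M]
  [RiemannianBundle (fun x : M ↦ TangentSpace (𝓡 n) x)] in
theorem measurableSet_symm_preimage_inter_target {A : Set M} (hA : MeasurableSet A) :
    MeasurableSet (e.symm ⁻¹' A ∩ e.target) := by
  have h1 : Measurable (e.target.domRestrict e.symm) :=
    (continuousOn_iff_continuous_domRestrict.1 e.continuousOn_symm).measurable
  have h2 := e.open_target.measurableSet.subtype_image (h1 hA)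
  convert h2 using 1
  ext y
  simp [and_comm]

omit [IsManifold (𝓡 n) ∞ M] in
theorem chartVol_apply {A : Set M} (hA : MeasurableSet A) :
    chartVol e A = ∫⁻ y in e.symm ⁻¹' A ∩ e.target, ENNReal.ofReal (volDensity e y) := by
  have hm : AEMeasurable e.symm ((volume.restrict e.target).withDensity
      fun y ↦ ENNReal.ofReal (volDensity e y)) :=
    (e.continuousOn_symm.aemeasurable e.open_target.measurableSet).mono_ac
      (withDensity_absolutelyContinuous _ _)
  rw [chartVol, Measure.map_apply_of_aemeasurable hm hA, withDensity_apply',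
    Measure.restrict_restrict' e.open_target.measurableSet]

/-- The volumes defined by two charts agree where both are defined, by the change of variables
formula. -/
theorem chartVol_eq_chartVol (he : e ∈ atlas (EuclideanSpace ℝ (Fin n)) M)
    (he' : e' ∈ atlas (EuclideanSpace ℝ (Fin n)) M) {A : Set M} (hA : MeasurableSet A)
    (hAe : A ⊆ e.source) (hAe' : A ⊆ e'.source) : chartVol e A = chartVol e' A := by
  rw [chartVol_apply hA, chartVol_apply hA]
  set S := e.symm ⁻¹' A ∩ e.target with hS
  have himage : e'.symm ⁻¹' A ∩ e'.target = (fun y ↦ e' (e.symm y)) '' S := by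
    ext z
    constructor
    · rintro ⟨hz, hzt⟩
      exact ⟨e (e'.symm z), ⟨by simpa [e.left_inv (hAe hz)] using hz, e.map_source (hAe hz)⟩,
        by simp [e.left_inv (hAe hz), e'.right_inv hzt]⟩
    · rintro ⟨y, ⟨hy, hyt⟩, rfl⟩
      exact ⟨by simpa [e'.left_inv (hAe' hy)] using hy, e'.map_source (hAe' hy)⟩
  have hinj : InjOn (fun y ↦ e' (e.symm y)) S := fun y hy z hz hyz ↦
    e.symm.injOn hy.2 hz.2 (e'.injOn (hAe' hy.1) (hAe' hz.1) hyz)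
  rw [himage, lintegral_image_eq_lintegral_abs_det_fderiv_mul volume
    (measurableSet_symm_preimage_inter_target hA)
    (fun y hy ↦ (hasFDerivAt_transition he he' hy.2 (hAe' hy.1)).hasFDerivWithinAt) hinj]
  refine setLIntegral_congr_fun (measurableSet_symm_preimage_inter_target hA) fun y hy ↦ ?_
  beta_reduce
  rw [volDensity_transition he' (hAe' hy.1), ENNReal.ofReal_mul (abs_nonneg _)]

end Atlas

variable [T2Space M] [CompactSpace M]

omit [RiemannianBundle (fun x : M ↦ TangentSpace (𝓡 n) x)] [MeasurableSpace M] [BorelSpace M] in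
theorem tsupport_chartPartition_subset (c : M) :
    tsupport (chartPartition n M c) ⊆ (chartAt (EuclideanSpace ℝ (Fin n)) c).source :=
  (SmoothPartitionOfUnity.exists_isSubordinate_chartAt_source (𝓡 n) M).choose_spec c

omit [RiemannianBundle (fun x : M ↦ TangentSpace (𝓡 n) x)] [MeasurableSpace M] [BorelSpace M] in
variable (n M) in
/-- By compactness, only finitely many members of the partition of unity do not vanish. -/
theorem exists_finset_chartPartition : ∃ s : Finset M,
    (∀ c ∉ s, ∀ x, chartPartition n M c x = 0) ∧ ∀ x, ∑ c ∈ s, chartPartition n M c x = 1 := by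
  have hfin := (chartPartition n M).locallyFinite.finite_nonempty_of_compact
  have h0 : ∀ c ∉ hfin.toFinset, ∀ x, chartPartition n M c x = 0 := fun c hc x ↦ by
    by_contra hx
    exact hc (hfin.mem_toFinset.2 ⟨x, hx⟩)
  refine ⟨hfin.toFinset, h0, fun x ↦ ?_⟩
  rw [← (chartPartition n M).sum_eq_one (mem_univ x)]
  refine (finsum_eq_sum_of_support_subset _ fun c hc ↦ ?_).symm
  by_contra hcs
  exact hc (h0 c hcs x)

/-- On the domain of a chart, the Riemannian volume is the volume defined by that chart. -/
theorem riemVol_apply_of_subset_source {c : M} {A : Set M} (hA : MeasurableSet A)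
    (hAc : A ⊆ (chartAt (EuclideanSpace ℝ (Fin n)) c).source) :
    riemVol n M A = chartVol (chartAt (EuclideanSpace ℝ (Fin n)) c) A := by
  set e := chartAt (EuclideanSpace ℝ (Fin n)) c
  obtain ⟨s, hs0, hs1⟩ := exists_finset_chartPartition n M
  -- the weight of the chart at `c'` vanishes off its domain, and within it the two chart volumes
  -- agree, so each term may be computed with the volume of `e`
  have hterm : ∀ c' : M, ((chartVol (chartAt (EuclideanSpace ℝ (Fin n)) c')).withDensity
      fun x ↦ ENNReal.ofReal (chartPartition n M c' x)) A =
        ∫⁻ x in A, ENNReal.ofReal (chartPartition n M c' x) ∂chartVol e := fun c' ↦ by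
    set e' := chartAt (EuclideanSpace ℝ (Fin n)) c'
    have hm' : MeasurableSet e'.source := e'.open_source.measurableSet
    have hcut : ∀ ν : Measure M, ∫⁻ x in A, ENNReal.ofReal (chartPartition n M c' x) ∂ν =
        ∫⁻ x in A ∩ e'.source, ENNReal.ofReal (chartPartition n M c' x) ∂ν := fun ν ↦ by
      rw [inter_comm, ← Measure.restrict_restrict hm']
      refine (setLIntegral_eq_of_support_subset fun x hx ↦ ?_).symm
      by_contra hxs
      refine hx ?_
      have : x ∉ tsupport (chartPartition n M c') := fun h ↦
        hxs (tsupport_chartPartition_subset c' h)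
      simp [image_eq_zero_of_notMem_tsupport this]
    have hres : (chartVol e').restrict (A ∩ e'.source) = (chartVol e).restrict (A ∩ e'.source) := by
      ext B hB
      rw [Measure.restrict_apply hB, Measure.restrict_apply hB]
      exact chartVol_eq_chartVol (chart_mem_atlas _ _) (chart_mem_atlas _ _)
        (hB.inter (hA.inter hm')) (fun x hx ↦ hx.2.2) (fun x hx ↦ hAc hx.2.1)
    rw [withDensity_apply _ hA, hcut, hres, ← hcut]
  rw [riemVol, Measure.sum_apply _ hA]
  simp_rw [hterm]
  rw [tsum_eq_sum (s := s) fun c' hc' ↦ by simp [hs0 c' hc'], ← lintegral_finsetSum]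
  · have : ∀ x, ∑ c' ∈ s, ENNReal.ofReal (chartPartition n M c' x) = 1 := fun x ↦ by
      rw [← ENNReal.ofReal_sum_of_nonneg fun c' _ ↦ (chartPartition n M).nonneg c' x, hs1,
        ENNReal.ofReal_one]
    simp [this]
  · exact fun c' _ ↦ (chartPartition n M c').contMDiff.continuous.measurable.ennreal_ofReal

theorem riemVol_restrict_source (c : M) :
    (riemVol n M).restrict (chartAt (EuclideanSpace ℝ (Fin n)) c).source =
      (chartVol (chartAt (EuclideanSpace ℝ (Fin n)) c)).restrict
        (chartAt (EuclideanSpace ℝ (Fin n)) c).source := by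
  ext B hB
  rw [Measure.restrict_apply hB, Measure.restrict_apply hB]
  exact riemVol_apply_of_subset_source
    (hB.inter (chartAt (EuclideanSpace ℝ (Fin n)) c).open_source.measurableSet) inter_subset_right

variable [IsContMDiffRiemannianBundle (𝓡 n) ∞ (EuclideanSpace ℝ (Fin n))
    (fun x : M ↦ TangentSpace (𝓡 n) x)]

instance isFiniteMeasure_riemVol : IsFiniteMeasure (riemVol n M) := by
  have : IsLocallyFiniteMeasure (riemVol n M) := ⟨fun x ↦ by
    set e := chartAt (EuclideanSpace ℝ (Fin n)) x with he
    have hx : x ∈ e.source := mem_chart_source _ x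
    have hy : e x ∈ e.target := e.map_source hx
    obtain ⟨r, hr, hball⟩ := Metric.nhds_basis_closedBall.mem_iff.1 (e.open_target.mem_nhds hy)
    have hop : IsOpen (e.source ∩ e ⁻¹' Metric.ball (e x) r) :=
      e.isOpen_inter_preimage Metric.isOpen_ball
    refine ⟨_, hop.mem_nhds ⟨hx, Metric.mem_ball_self hr⟩, ?_⟩
    rw [riemVol_apply_of_subset_source (c := x) hop.measurableSet inter_subset_left,
      chartVol_apply hop.measurableSet]
    have hint : IntegrableOn (volDensity e) (Metric.closedBall (e x) r) :=
      ((contDiffOn_volDensity x).continuousOn.mono hball).integrableOn_compact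
        (isCompact_closedBall _ _)
    refine (lintegral_mono_set ?_).trans_lt hint.lintegral_lt_top
    rintro y ⟨⟨-, hyb⟩, hyt⟩
    rw [mem_preimage, e.right_inv hyt] at hyb
    exact Metric.ball_subset_closedBall hyb⟩
  infer_instance

instance isOpenPosMeasure_riemVol : (riemVol n M).IsOpenPosMeasure := ⟨fun U hU ⟨x, hxU⟩ h0 ↦ by
  set e := chartAt (EuclideanSpace ℝ (Fin n)) x with he
  have hx : x ∈ e.source := mem_chart_source _ x
  have hop : IsOpen (U ∩ e.source) := hU.inter e.open_source
  have h1 : riemVol n M (U ∩ e.source) = 0 := measure_mono_null inter_subset_left h0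
  rw [riemVol_apply_of_subset_source (c := x) hop.measurableSet inter_subset_right,
    chartVol_apply hop.measurableSet] at h1
  set S := e.symm ⁻¹' (U ∩ e.source) ∩ e.target with hS
  have hSo : IsOpen S := by
    rw [hS, inter_comm]
    exact e.isOpen_inter_preimage_symm hop
  have hSt : S ⊆ e.target := inter_subset_right
  rw [lintegral_eq_zero_iff' (((contDiffOn_volDensity x).continuousOn.mono hSt).aemeasurable
    hSo.measurableSet).ennreal_ofReal] at h1
  have h2 : ∀ᵐ y ∂(volume.restrict S), False := by
    filter_upwards [h1, ae_restrict_mem hSo.measurableSet] with y hy hyS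
    rw [Pi.zero_apply, ENNReal.ofReal_eq_zero] at hy
    exact absurd (volDensity_pos (chart_mem_atlas _ x) (hSt hyS)) hy.not_gt
  rw [eventually_false_iff_eq_bot, ae_eq_bot, Measure.restrict_eq_zero] at h2
  exact (hSo.measure_pos volume ⟨e x, by simpa [e.left_inv hx] using ⟨hxU, hx⟩,
    e.map_source hx⟩).ne' h2⟩

/-- Integration in a chart of a function that vanishes off the domain of the chart. -/
theorem integral_riemVol_eq_setIntegral {c : M} {h : M → ℝ}
    (hc : ContinuousOn h (chartAt (EuclideanSpace ℝ (Fin n)) c).source)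
    (h0 : ∀ x ∉ (chartAt (EuclideanSpace ℝ (Fin n)) c).source, h x = 0) :
    ∫ x, h x ∂(riemVol n M) = ∫ y in (chartAt (EuclideanSpace ℝ (Fin n)) c).target,
      h ((chartAt (EuclideanSpace ℝ (Fin n)) c).symm y) *
        volDensity (chartAt (EuclideanSpace ℝ (Fin n)) c) y := by
  set e := chartAt (EuclideanSpace ℝ (Fin n)) c with he
  have hms : MeasurableSet e.source := e.open_source.measurableSet
  have hmt : MeasurableSet e.target := e.open_target.measurableSet
  have hnull : chartVol e e.sourceᶜ = 0 := by
    rw [chartVol_apply hms.compl]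
    have : e.symm ⁻¹' e.sourceᶜ ∩ e.target = ∅ := by
      ext y
      simp only [mem_inter_iff, mem_preimage, mem_compl_iff, mem_empty_iff_false, iff_false,
        not_and]
      exact fun h1 h2 ↦ h1 (e.map_target h2)
    rw [this, setLIntegral_empty]
  have hfull : (chartVol e).restrict e.source = chartVol e :=
    Measure.restrict_eq_self_of_ae_mem (by rwa [ae_iff])
  have hm : AEMeasurable e.symm ((volume.restrict e.target).withDensity
      fun y ↦ ENNReal.ofReal (volDensity e y)) :=
    (e.continuousOn_symm.aemeasurable hmt).mono_ac (withDensity_absolutelyContinuous _ _)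
  rw [← setIntegral_eq_integral_of_forall_compl_eq_zero h0, riemVol_restrict_source, hfull,
    chartVol, integral_map hm]
  · simp only [ENNReal.ofReal]
    rw [integral_withDensity_eq_integral_smul₀]
    · refine setIntegral_congr_fun hmt fun y hy ↦ ?_
      rw [NNReal.smul_def, Real.coe_toNNReal _ (show 0 ≤ volDensity e y from Real.sqrt_nonneg _),
        smul_eq_mul, mul_comm]
    · exact ((contDiffOn_volDensity c).continuousOn.aemeasurable hmt).real_toNNReal
  · change AEStronglyMeasurable h (chartVol e)
    rw [← hfull]
    exact hc.aestronglyMeasurable hms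

end Volume

/-! ### The divergence theorem on a compact Riemannian manifold -/

section DirDeriv

variable {n : ℕ} {M : Type*} [TopologicalSpace M] [ChartedSpace (EuclideanSpace ℝ (Fin n)) M]

/-- The derivative `dφ(V)` of the function `φ` along the vector field `V`. -/
noncomputable def dirDeriv (φ : M → ℝ) (V : ∀ x : M, TangentSpace (𝓡 n) x) (x : M) : ℝ :=
  (mfderiv (𝓡 n) 𝓘(ℝ, ℝ) φ x : TangentSpace (𝓡 n) x →L[ℝ] ℝ) (V x)

theorem dirDeriv_sum {ι : Type*} (s : Finset ι) {φ : ι → M → ℝ}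
    (hφ : ∀ i ∈ s, ContMDiff (𝓡 n) 𝓘(ℝ, ℝ) 1 (φ i)) (V : ∀ x : M, TangentSpace (𝓡 n) x) (x : M) :
    dirDeriv (fun y ↦ ∑ i ∈ s, φ i y) V x = ∑ i ∈ s, dirDeriv (φ i) V x := by
  classical
  induction s using Finset.induction_on with
  | empty =>
    simp only [Finset.sum_empty, dirDeriv, mfderiv_const]
    rfl
  | insert i s hi ih =>
    have h1 := ((hφ i (Finset.mem_insert_self i s)).mdifferentiableAt one_ne_zero
      (x := x)).hasMFDerivAt
    have hs : ∀ j ∈ s, ContMDiff (𝓡 n) 𝓘(ℝ, ℝ) 1 (φ j) :=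
      fun j hj ↦ hφ j (Finset.mem_insert_of_mem hj)
    have h2 := ((contMDiff_finsetSum hs).mdifferentiableAt one_ne_zero (x := x)).hasMFDerivAt
    simp only [Finset.sum_insert hi]
    rw [← ih hs]
    have h3 := (h1.add h2).mfderiv
    exact DFunLike.congr_fun h3 (V x)

theorem dirDeriv_eq_zero_of_notMem_tsupport {φ : M → ℝ} (V : ∀ x : M, TangentSpace (𝓡 n) x) {x : M}
    (hx : x ∉ tsupport φ) : dirDeriv φ V x = 0 := by
  have h : φ =ᶠ[𝓝 x] fun _ ↦ 0 := notMem_tsupport_iff_eventuallyEq.1 hx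
  rw [dirDeriv, h.mfderiv_eq, mfderiv_const]
  rfl

variable [IsManifold (𝓡 n) ∞ M]

/-- In the chart `e`, `dφ(V) = ∑ i, ∂_i φ V^i`. -/
theorem dirDeriv_symm_eq_sum {e : OpenPartialHomeomorph M (EuclideanSpace ℝ (Fin n))}
    (he : e ∈ atlas (EuclideanSpace ℝ (Fin n)) M) {φ : M → ℝ}
    (hφ : ContMDiff (𝓡 n) 𝓘(ℝ, ℝ) 1 φ) (V : ∀ x : M, TangentSpace (𝓡 n) x)
    {y : EuclideanSpace ℝ (Fin n)} (hy : y ∈ e.target) :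
    dirDeriv φ V (e.symm y) = ∑ i, fderiv ℝ (fun z ↦ φ (e.symm z)) y
      (EuclideanSpace.single i 1) * coordComp e V i y := by
  have h1 := (hφ.mdifferentiableAt one_ne_zero (x := e.symm y)).hasMFDerivAt
  have h2 := (mdifferentiableAt_atlas_symm (I := 𝓡 n) he hy).hasMFDerivAt
  let A : EuclideanSpace ℝ (Fin n) →L[ℝ] ℝ := mfderiv (𝓡 n) 𝓘(ℝ, ℝ) φ (e.symm y)
  have h3 : HasFDerivAt (fun z ↦ φ (e.symm z)) (A.comp (frame n e y)) y :=
    (h1.comp y h2).hasFDerivAt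
  set w : EuclideanSpace ℝ (Fin n) := coframe n e (e.symm y) (V (e.symm y)) with hw
  have h4 : frame n e y w = V (e.symm y) := by
    have := frame_coframe he (e.map_target hy) (V (e.symm y))
    rwa [e.right_inv hy] at this
  have h5 : dirDeriv φ V (e.symm y) = fderiv ℝ (fun z ↦ φ (e.symm z)) y w := by
    rw [h3.fderiv]
    change A _ = A (frame n e y w)
    rw [h4]
  have h6 : ∀ i, coordComp e V i y = w i := fun i ↦ rfl
  rw [h5]
  conv_lhs => rw [← (EuclideanSpace.basisFun (Fin n) ℝ).sum_repr w]
  simp [h6, mul_comm]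

theorem contDiffOn_comp_chart_symm {φ : M → ℝ} (hφ : ContMDiff (𝓡 n) 𝓘(ℝ, ℝ) 1 φ) (c : M) :
    ContDiffOn ℝ 1 (fun y ↦ φ ((chartAt (EuclideanSpace ℝ (Fin n)) c).symm y))
      (chartAt (EuclideanSpace ℝ (Fin n)) c).target := by
  rw [← contMDiffOn_iff_contDiffOn]
  exact hφ.comp_contMDiffOn ((contMDiffOn_chart_symm (n := ∞) (x := c)).of_le (by simp))

theorem continuous_dirDeriv {φ : M → ℝ} (hφ : ContMDiff (𝓡 n) 𝓘(ℝ, ℝ) 1 φ)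
    {V : ∀ x : M, TangentSpace (𝓡 n) x}
    (hV : ContMDiff (𝓡 n) (𝓡 n).tangent 1 (fun x ↦ (⟨x, V x⟩ : TangentBundle (𝓡 n) M))) :
    Continuous (dirDeriv φ V) := by
  rw [continuous_iff_continuousAt]
  intro c
  set e := chartAt (EuclideanSpace ℝ (Fin n)) c with he
  have h1 : ContinuousOn (fun y ↦ ∑ i, fderiv ℝ (fun z ↦ φ (e.symm z)) y
      (EuclideanSpace.single i 1) * coordComp e V i y) e.target :=
    continuousOn_finsetSum _ fun i _ ↦
      (((contDiffOn_comp_chart_symm hφ c).continuousOn_fderiv_of_isOpen e.open_target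
        le_rfl).clm_apply continuousOn_const).mul (contDiffOn_coordComp hV c i).continuousOn
  have h2 := h1.comp e.continuousOn fun x hx ↦ e.map_source hx
  refine (h2.congr fun x hx ↦ ?_).continuousAt (e.open_source.mem_nhds (mem_chart_source _ c))
  have h3 := dirDeriv_symm_eq_sum (chart_mem_atlas _ c) hφ V (e.map_source hx)
  rwa [e.left_inv hx] at h3

end DirDeriv

section Divergence

variable {n : ℕ} {M : Type*} [TopologicalSpace M] [ChartedSpace (EuclideanSpace ℝ (Fin n)) M]
  [IsManifold (𝓡 n) ∞ M] [RiemannianBundle (fun x : M ↦ TangentSpace (𝓡 n) x)]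

/-- The coordinate expression `(1 / √det g) ∑ i, ∂_i (√det g V^i)` in a fixed chart `e`, as a
function on the manifold. The Riemannian divergence at `x` is its value for the preferred chart
at `x`. -/
noncomputable def chartDiv (e : OpenPartialHomeomorph M (EuclideanSpace ℝ (Fin n)))
    (V : ∀ x : M, TangentSpace (𝓡 n) x) (x : M) : ℝ :=
  (volDensity e (e x))⁻¹ * ∑ i, fderiv ℝ (fun y ↦ volDensity e y * coordComp e V i y) (e x)
    (EuclideanSpace.single i 1)

variable [IsContMDiffRiemannianBundle (𝓡 n) ∞ (EuclideanSpace ℝ (Fin n))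
    (fun x : M ↦ TangentSpace (𝓡 n) x)]

section Field

variable {V : ∀ x : M, TangentSpace (𝓡 n) x}

theorem contDiffOn_volDensity_mul_coordComp
    (hV : ContMDiff (𝓡 n) (𝓡 n).tangent 1 (fun x ↦ (⟨x, V x⟩ : TangentBundle (𝓡 n) M)))
    (c : M) (i : Fin n) :
    ContDiffOn ℝ 1 (fun y ↦ volDensity (chartAt (EuclideanSpace ℝ (Fin n)) c) y *
      coordComp (chartAt (EuclideanSpace ℝ (Fin n)) c) V i y)
      (chartAt (EuclideanSpace ℝ (Fin n)) c).target :=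
  ((contDiffOn_volDensity c).of_le (by simp)).mul (contDiffOn_coordComp hV c i)

theorem continuousOn_chartDiv
    (hV : ContMDiff (𝓡 n) (𝓡 n).tangent 1 (fun x ↦ (⟨x, V x⟩ : TangentBundle (𝓡 n) M)))
    (c : M) : ContinuousOn (chartDiv (chartAt (EuclideanSpace ℝ (Fin n)) c) V)
      (chartAt (EuclideanSpace ℝ (Fin n)) c).source := by
  set e := chartAt (EuclideanSpace ℝ (Fin n)) c with he
  have h1 : ContinuousOn (fun y ↦ (volDensity e y)⁻¹ * ∑ i,
      fderiv ℝ (fun y ↦ volDensity e y * coordComp e V i y) y (EuclideanSpace.single i 1))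
      e.target :=
    ((contDiffOn_volDensity c).continuousOn.inv₀
      fun y hy ↦ (volDensity_pos (chart_mem_atlas _ c) hy).ne').mul
    (continuousOn_finsetSum _ fun i _ ↦
      (((contDiffOn_volDensity_mul_coordComp hV c i).continuousOn_fderiv_of_isOpen e.open_target
        le_rfl).clm_apply continuousOn_const))
  exact h1.comp e.continuousOn fun x hx ↦ e.map_source hx

variable [T2Space M] [CompactSpace M] [MeasurableSpace M] [BorelSpace M]

/-- The divergence theorem in a chart, tested against functions supported in its domain. -/
theorem integral_mul_chartDiv
    (hV : ContMDiff (𝓡 n) (𝓡 n).tangent 1 (fun x ↦ (⟨x, V x⟩ : TangentBundle (𝓡 n) M)))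
    {c : M} {φ : M → ℝ} (hφ : ContMDiff (𝓡 n) 𝓘(ℝ, ℝ) 1 φ)
    (hs : tsupport φ ⊆ (chartAt (EuclideanSpace ℝ (Fin n)) c).source) :
    ∫ x, φ x * chartDiv (chartAt (EuclideanSpace ℝ (Fin n)) c) V x ∂(riemVol n M) =
      -∫ x, dirDeriv φ V x ∂(riemVol n M) := by
  set e := chartAt (EuclideanSpace ℝ (Fin n)) c with he
  have hat : e ∈ atlas (EuclideanSpace ℝ (Fin n)) M := chart_mem_atlas _ c
  set ψ : EuclideanSpace ℝ (Fin n) → ℝ := fun y ↦ φ (e.symm y) with hψ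
  have hK : IsCompact (e '' tsupport φ) :=
    (isClosed_tsupport φ).isCompact.image_of_continuousOn (e.continuousOn.mono hs)
  have hKt : e '' tsupport φ ⊆ e.target := by
    rintro _ ⟨x, hx, rfl⟩
    exact e.map_source (hs hx)
  have hψ0 : ∀ y ∈ e.target \ e '' tsupport φ, ψ y = 0 := fun y hy ↦
    image_eq_zero_of_notMem_tsupport (f := φ)
      fun h ↦ hy.2 ⟨e.symm y, h, e.right_inv hy.1⟩
  have key := fun i : Fin n ↦ setIntegral_mul_fderiv_eq_neg (μ := volume) e.open_target hK hKt
    (contDiffOn_comp_chart_symm hφ c) (contDiffOn_volDensity_mul_coordComp hV c i) hψ0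
    (EuclideanSpace.single i 1)
  rw [integral_riemVol_eq_setIntegral (c := c) (h := fun x ↦ φ x * chartDiv e V x)
      (hφ.continuous.continuousOn.mul (continuousOn_chartDiv hV c))
      (fun x hx ↦ by rw [image_eq_zero_of_notMem_tsupport fun h ↦ hx (hs h), zero_mul]),
    integral_riemVol_eq_setIntegral (c := c) (continuous_dirDeriv hφ hV).continuousOn
      (fun x hx ↦ dirDeriv_eq_zero_of_notMem_tsupport V fun h ↦ hx (hs h))]
  have e1 : ∀ y ∈ e.target, φ (e.symm y) * chartDiv e V (e.symm y) * volDensity e y =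
      ∑ i, ψ y * fderiv ℝ (fun y ↦ volDensity e y * coordComp e V i y) y
        (EuclideanSpace.single i 1) := fun y hy ↦ by
    have := (volDensity_pos hat hy).ne'
    rw [chartDiv, e.right_inv hy, ← Finset.mul_sum]
    field_simp
    exact mul_comm _ _
  have e2 : ∀ y ∈ e.target, dirDeriv φ V (e.symm y) * volDensity e y =
      ∑ i, fderiv ℝ ψ y (EuclideanSpace.single i 1) *
        (volDensity e y * coordComp e V i y) := fun y hy ↦ by
    rw [dirDeriv_symm_eq_sum hat hφ V hy, Finset.sum_mul]
    exact Finset.sum_congr rfl fun i _ ↦ by ring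
  rw [setIntegral_congr_fun e.open_target.measurableSet e1,
    setIntegral_congr_fun e.open_target.measurableSet e2,
    integral_finsetSum _ fun i _ ↦ (key i).1, integral_finsetSum _ fun i _ ↦ (key i).2.1,
    ← Finset.sum_neg_distrib]
  exact Finset.sum_congr rfl fun i _ ↦ (key i).2.2

omit [ChartedSpace (EuclideanSpace ℝ (Fin n)) M] [IsManifold (𝓡 n) ∞ M]
  [RiemannianBundle (fun x : M ↦ TangentSpace (𝓡 n) x)]
  [IsContMDiffRiemannianBundle (𝓡 n) ∞ (EuclideanSpace ℝ (Fin n))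
    (fun x : M ↦ TangentSpace (𝓡 n) x)] [T2Space M] [CompactSpace M]
  [MeasurableSpace M] [BorelSpace M] in
theorem continuous_mul_of_tsupport_subset {U : Set M} (hU : IsOpen U) {φ h : M → ℝ}
    (hφ : Continuous φ) (hs : tsupport φ ⊆ U) (hh : ContinuousOn h U) :
    Continuous fun x ↦ φ x * h x :=
  continuous_of_tsupport fun _ hx ↦
    hφ.continuousAt.mul (hh.continuousAt (hU.mem_nhds (hs (tsupport_mul_subset_left hx))))

/-- The coordinate expression of the divergence does not depend on the chart: both expressions are
continuous and have the same integrals against all test functions, since `dφ(V)` and the volume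
do not depend on the chart. -/
theorem chartDiv_eq_chartDiv
    (hV : ContMDiff (𝓡 n) (𝓡 n).tangent 1 (fun x ↦ (⟨x, V x⟩ : TangentBundle (𝓡 n) M)))
    {c c' x : M} (hx : x ∈ (chartAt (EuclideanSpace ℝ (Fin n)) c).source)
    (hx' : x ∈ (chartAt (EuclideanSpace ℝ (Fin n)) c').source) :
    chartDiv (chartAt (EuclideanSpace ℝ (Fin n)) c) V x =
      chartDiv (chartAt (EuclideanSpace ℝ (Fin n)) c') V x := by
  set e := chartAt (EuclideanSpace ℝ (Fin n)) c with he
  set e' := chartAt (EuclideanSpace ℝ (Fin n)) c' with he'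
  have hU : IsOpen (e.source ∩ e'.source) := e.open_source.inter e'.open_source
  have hc : ContinuousOn (chartDiv e V) (e.source ∩ e'.source) :=
    (continuousOn_chartDiv hV c).mono inter_subset_left
  have hc' : ContinuousOn (chartDiv e' V) (e.source ∩ e'.source) :=
    (continuousOn_chartDiv hV c').mono inter_subset_right
  have hae := hU.ae_eq_zero_of_integral_contMDiff_smul_eq_zero (𝓡 n) (μ := riemVol n M)
    (f := fun x ↦ chartDiv e V x - chartDiv e' V x)
    ((hc.sub hc').locallyIntegrableOn hU.measurableSet) fun g hg _ hgs ↦ by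
      have hg1 : ContMDiff (𝓡 n) 𝓘(ℝ, ℝ) 1 g := hg.of_le (by simp)
      have i1 : Integrable (fun x ↦ g x * chartDiv e V x) (riemVol n M) :=
        (continuous_mul_of_tsupport_subset hU hg.continuous hgs
          hc).integrable_of_hasCompactSupport (.of_compactSpace _)
      have i2 : Integrable (fun x ↦ g x * chartDiv e' V x) (riemVol n M) :=
        (continuous_mul_of_tsupport_subset hU hg.continuous hgs
          hc').integrable_of_hasCompactSupport (.of_compactSpace _)
      simp only [smul_eq_mul, mul_sub]
      rw [integral_sub i1 i2, integral_mul_chartDiv hV hg1 (hgs.trans inter_subset_left),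
        integral_mul_chartDiv hV hg1 (hgs.trans inter_subset_right), sub_self]
  refine Measure.eqOn_open_of_ae_eq (μ := riemVol n M) ?_ hU hc hc' ⟨hx, hx'⟩
  filter_upwards [(ae_restrict_iff' hU.measurableSet).2 hae] with y hy using sub_eq_zero.1 hy

theorem riemDiv_eq_chartDiv
    (hV : ContMDiff (𝓡 n) (𝓡 n).tangent 1 (fun x ↦ (⟨x, V x⟩ : TangentBundle (𝓡 n) M)))
    {c x : M} (hx : x ∈ (chartAt (EuclideanSpace ℝ (Fin n)) c).source) :
    riemDiv V x = chartDiv (chartAt (EuclideanSpace ℝ (Fin n)) c) V x :=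
  chartDiv_eq_chartDiv hV (mem_chart_source _ x) hx

/-- The divergence theorem on a compact Riemannian manifold without boundary:
`∫ Φ div V = -∫ dΦ(V)`. -/
theorem integral_mul_riemDiv
    (hV : ContMDiff (𝓡 n) (𝓡 n).tangent 1 (fun x ↦ (⟨x, V x⟩ : TangentBundle (𝓡 n) M)))
    {Φ : M → ℝ} (hΦ : ContMDiff (𝓡 n) 𝓘(ℝ, ℝ) 1 Φ) :
    ∫ x, Φ x * riemDiv V x ∂(riemVol n M) = -∫ x, dirDeriv Φ V x ∂(riemVol n M) := by
  obtain ⟨s, -, hs1⟩ := exists_finset_chartPartition n M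
  set χ : M → M → ℝ := fun c x ↦ chartPartition n M c x * Φ x with hχ
  have hχs : ∀ c, tsupport (χ c) ⊆ (chartAt (EuclideanSpace ℝ (Fin n)) c).source := fun c ↦
    tsupport_mul_subset_left.trans (tsupport_chartPartition_subset c)
  have hχ1 : ∀ c, ContMDiff (𝓡 n) 𝓘(ℝ, ℝ) 1 (χ c) := fun c ↦
    ((chartPartition n M c).contMDiff.of_le (by simp)).mul hΦ
  have hsum : Φ = fun x ↦ ∑ c ∈ s, χ c x := by
    ext x
    rw [← Finset.sum_mul, hs1, one_mul]
  have hχV : ∀ c x, χ c x * riemDiv V x =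
      χ c x * chartDiv (chartAt (EuclideanSpace ℝ (Fin n)) c) V x := fun c x ↦ by
    by_cases hx : x ∈ (chartAt (EuclideanSpace ℝ (Fin n)) c).source
    · rw [riemDiv_eq_chartDiv hV hx]
    · rw [image_eq_zero_of_notMem_tsupport fun h ↦ hx (hχs c h), zero_mul, zero_mul]
  have h1 : ∀ x, Φ x * riemDiv V x =
      ∑ c ∈ s, χ c x * chartDiv (chartAt (EuclideanSpace ℝ (Fin n)) c) V x := fun x ↦ by
    conv_lhs => rw [hsum]
    rw [Finset.sum_mul]
    exact Finset.sum_congr rfl fun c _ ↦ hχV c x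
  -- the partition sums to `1`, so the derivatives of the cutoffs drop out without a product rule
  have h2 : ∀ x, dirDeriv Φ V x = ∑ c ∈ s, dirDeriv (χ c) V x := fun x ↦ by
    conv_lhs => rw [hsum]
    exact dirDeriv_sum s (fun c _ ↦ hχ1 c) V x
  simp_rw [h1, h2]
  rw [integral_finsetSum, integral_finsetSum, ← Finset.sum_neg_distrib]
  · exact Finset.sum_congr rfl fun c _ ↦ integral_mul_chartDiv hV (hχ1 c) (hχs c)
  · exact fun c _ ↦ (continuous_dirDeriv (hχ1 c) hV).integrable_of_hasCompactSupport
      (.of_compactSpace _)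
  · exact fun c _ ↦ (continuous_mul_of_tsupport_subset
      (chartAt (EuclideanSpace ℝ (Fin n)) c).open_source (hχ1 c).continuous (hχs c)
      (continuousOn_chartDiv hV c)).integrable_of_hasCompactSupport (.of_compactSpace _)

end Field

end Divergence

/-! ### Energy dissipation on a compact Riemannian manifold -/

section RiemannianFlow

variable {n : ℕ} {M : Type*} [TopologicalSpace M] [ChartedSpace (EuclideanSpace ℝ (Fin n)) M]
  [IsManifold (𝓡 n) ∞ M]

theorem continuousOn_derivWithin_time_manifold {q : ℝ → M → ℝ}
    (hq : ContMDiffOn (𝓘(ℝ, ℝ).prod (𝓡 n)) 𝓘(ℝ, ℝ) 1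
      (fun z : ℝ × M ↦ q z.1 z.2) (Ici 0 ×ˢ univ)) :
    ContinuousOn (fun z : ℝ × M ↦ derivWithin (fun s ↦ q s z.2) (Ici 0) z.1)
      (Ici 0 ×ˢ univ) := by
  rintro ⟨t, c⟩ ⟨ht, -⟩
  set e := chartAt (EuclideanSpace ℝ (Fin n)) c with he
  have h1 : ContMDiffOn 𝓘(ℝ, ℝ × EuclideanSpace ℝ (Fin n)) (𝓘(ℝ, ℝ).prod (𝓡 n)) 1
      (fun z : ℝ × EuclideanSpace ℝ (Fin n) ↦ (z.1, e.symm z.2)) (Ici 0 ×ˢ e.target) :=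
    (contDiff_fst.contMDiff.contMDiffOn).prodMk
      (((contMDiffOn_chart_symm (n := ∞) (x := c)).of_le (by simp)).comp
        contDiff_snd.contMDiff.contMDiffOn fun z hz ↦ hz.2)
  have h2 : ContDiffOn ℝ 1 (fun z : ℝ × EuclideanSpace ℝ (Fin n) ↦ q z.1 (e.symm z.2))
      (Ici 0 ×ˢ e.target) := by
    rw [← contMDiffOn_iff_contDiffOn]
    exact hq.comp h1 fun z hz ↦ ⟨hz.1, trivial⟩
  have h3 : ContinuousOn (fun z : ℝ × M ↦ (z.1, e z.2)) (Ici 0 ×ˢ e.source) :=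
    continuousOn_fst.prodMk (e.continuousOn.comp continuousOn_snd fun z hz ↦ hz.2)
  have h4 := (continuousOn_derivWithin_time e.open_target h2).comp h3
    fun z hz ↦ ⟨hz.1, e.map_source hz.2⟩
  have h5 : ContinuousOn (fun z : ℝ × M ↦ derivWithin (fun s ↦ q s z.2) (Ici 0) z.1)
      (Ici 0 ×ˢ e.source) := h4.congr fun z hz ↦ by
    simp [e.left_inv hz.2]
  refine (h5 (t, c) ⟨ht, mem_chart_source _ c⟩).mono_of_mem_nhdsWithin ?_
  have h6 : (univ : Set ℝ) ×ˢ e.source ∈ 𝓝 (t, c) :=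
    (isOpen_univ.prod e.open_source).mem_nhds ⟨trivial, mem_chart_source _ c⟩
  filter_upwards [nhdsWithin_le_nhds h6, self_mem_nhdsWithin] with z hz1 hz2 using ⟨hz2.1, hz1.2⟩

variable [RiemannianBundle (fun x : M ↦ TangentSpace (𝓡 n) x)] {f : ℝ → ℝ} {p : M → ℝ}
  {q : ℝ → M → ℝ}

omit [IsManifold (𝓡 n) ∞ M] in
theorem dirDeriv_smul_riemVelocity (f : ℝ → ℝ) (ρ p : M → ℝ) (x : M) :
    dirDeriv (potential f ρ p) (fun y ↦ ρ y • riemVelocity (n := n) f ρ p y) x =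
      -(ρ x * ‖grad (n := n) (potential f ρ p) x‖ ^ 2) := by
  have hgrad : dirDeriv (potential f ρ p) (fun y ↦ ρ y • riemVelocity (n := n) f ρ p y) x =
      inner ℝ (grad (n := n) (potential f ρ p) x) (ρ x • riemVelocity (n := n) f ρ p x) := by
    have : FiniteDimensional ℝ (TangentSpace (𝓡 n) x) :=
      inferInstanceAs (FiniteDimensional ℝ (EuclideanSpace ℝ (Fin n)))
    have : CompleteSpace (TangentSpace (𝓡 n) x) := FiniteDimensional.complete ℝ _
    exact (InnerProductSpace.toDual_symm_apply (𝕜 := ℝ) (E := TangentSpace (𝓡 n) x)).symm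
  rw [hgrad, riemVelocity, inner_smul_right, inner_neg_right, real_inner_self_eq_norm_sq,
    mul_neg]

variable [T2Space M] [CompactSpace M] [MeasurableSpace M] [BorelSpace M]
  [IsContMDiffRiemannianBundle (𝓡 n) ∞ (EuclideanSpace ℝ (Fin n))
    (fun x : M ↦ TangentSpace (𝓡 n) x)]

/-- Energy dissipation along a classical flow on a compact Riemannian manifold. -/
theorem IsRiemFlow.hasDerivWithinAt_fDiv (hf' : ContDiffOn ℝ 1 f (Ioi 0)) (hp : Continuous p)
    (hp0 : ∀ x, 0 < p x) (hq : IsRiemFlow (n := n) f p q) {t : ℝ} (ht : 0 ≤ t) :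
    Integrable (fun x ↦ p x * f (q t x / p x)) (riemVol n M) ∧
      Integrable (fun x ↦ q t x * ‖grad (n := n) (potential f (q t) p) x‖ ^ 2) (riemVol n M) ∧
      HasDerivWithinAt (fun s ↦ fDiv (riemVol n M) f (q s) p)
        (-∫ x, q t x * ‖grad (n := n) (potential f (q t) p) x‖ ^ 2 ∂(riemVol n M)) (Ici 0) t := by
  have hqc := hq.contMDiffOn.continuousOn
  have hint : ∀ s, 0 ≤ s → Integrable (fun x ↦ p x * f (q s x / p x)) (riemVol n M) :=
    fun s hs ↦ (continuous_energyDensity hf' hp hp0 (continuous_slice hqc hs)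
      (hq.pos s hs)).integrable_of_hasCompactSupport (.of_compactSpace _)
  have hder : ∀ s, 0 ≤ s → ∀ x, HasDerivWithinAt (fun r ↦ q r x)
      (derivWithin (fun r ↦ q r x) (Ici 0) s) (Ici 0) s := fun s hs x ↦
    (hq.continuity_eq s hs x).differentiableWithinAt.hasDerivWithinAt
  have hE := hasDerivWithinAt_integral_Ici (μ := riemVol n M)
    (u := fun s x ↦ potential f (q s) p x * derivWithin (fun r ↦ q r x) (Ici 0) s) hint
    (.of_forall fun x s hs ↦
      hasDerivWithinAt_energyDensity hf' (hp0 x) (hq.pos s hs x) (hder s hs x))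
    (fun T ↦ by
      obtain ⟨C, hC⟩ := exists_bound_of_continuousOn
        ((continuousOn_potential hf' hp hp0 hq.pos hqc).mul
          (continuousOn_derivWithin_time_manifold hq.contMDiffOn)) (isCompact_univ (X := M)) T
      exact ⟨C, .of_forall fun x ↦ hC x trivial⟩) ht
  have hu : ∀ x, potential f (q t) p x * derivWithin (fun r ↦ q r x) (Ici 0) t =
      -(potential f (q t) p x *
        riemDiv (n := n) (fun y ↦ q t y • riemVelocity (n := n) f (q t) p y) x) := fun x ↦ by
    rw [(hq.continuity_eq t ht x).derivWithin (uniqueDiffOn_Ici 0 t ht), mul_neg]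
  have hdiv := integral_mul_riemDiv (hq.contMDiff_flux t ht) (hq.contMDiff_potential t ht)
  have hcd := continuous_dirDeriv (hq.contMDiff_potential t ht) (hq.contMDiff_flux t ht)
  have hdis := dirDeriv_smul_riemVelocity (n := n) f (q t) p
  have hi : Integrable (fun x ↦ q t x * ‖grad (n := n) (potential f (q t) p) x‖ ^ 2)
      (riemVol n M) := by
    refine (hcd.integrable_of_hasCompactSupport (.of_compactSpace _)).neg.congr
      (.of_forall fun x ↦ ?_)
    rw [Pi.neg_apply, hdis, neg_neg]
  refine ⟨hint t ht, hi, ?_⟩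
  simp_rw [hdis] at hdiv
  simp_rw [hu] at hE
  rwa [integral_neg, hdiv, integral_neg, neg_neg] at hE

end RiemannianFlow

end FDivFlow

theorem theorem3 (f : ℝ → ℝ) (hf : StrictConvexOn ℝ (Ioi 0) f) (hf' : ContDiffOn ℝ 1 f (Ioi 0)) :
    (∀ (d : ℕ) (p : EuclideanSpace ℝ (Fin d) → ℝ) (q : ℝ → EuclideanSpace ℝ (Fin d) → ℝ),
      ContDiff ℝ 1 p → (∀ x, 0 < p x) →
      FDivFlow.IsFlow f p q →
      (∀ t, 0 ≤ t → Integrable (fun x ↦ p x * f (q t x / p x))) →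
      FDivFlow.HasUniformTailDecay f p q →
      (∀ t, 0 ≤ t → Tendsto (FDivFlow.boundaryTerm f (q t) p) atTop (𝓝 0)) →
      ∀ t, 0 ≤ t →
        Integrable (fun x ↦ q t x * ‖gradient (FDivFlow.potential f (q t) p) x‖ ^ 2) ∧
        HasDerivWithinAt (fun s ↦ FDivFlow.fDiv volume f (q s) p)
          (-∫ x, q t x * ‖gradient (FDivFlow.potential f (q t) p) x‖ ^ 2) (Ici 0) t ∧
        -∫ x, q t x * ‖gradient (FDivFlow.potential f (q t) p) x‖ ^ 2 ≤ 0) ∧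
    (∀ (n : ℕ) (M : Type*) [TopologicalSpace M] [T2Space M] [CompactSpace M]
      [ChartedSpace (EuclideanSpace ℝ (Fin n)) M] [IsManifold (𝓡 n) ∞ M]
      [RiemannianBundle (fun x : M ↦ TangentSpace (𝓡 n) x)]
      [IsContMDiffRiemannianBundle (𝓡 n) ∞ (EuclideanSpace ℝ (Fin n))
        (fun x : M ↦ TangentSpace (𝓡 n) x)]
      [MeasurableSpace M] [BorelSpace M] (p : M → ℝ) (q : ℝ → M → ℝ),
      ContMDiff (𝓡 n) 𝓘(ℝ, ℝ) 1 p → (∀ x, 0 < p x) →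
      FDivFlow.IsRiemFlow (n := n) f p q →
      ∀ t, 0 ≤ t →
        Integrable (fun x ↦ p x * f (q t x / p x)) (FDivFlow.riemVol n M) ∧
        Integrable (fun x ↦ q t x * ‖FDivFlow.grad (n := n) (FDivFlow.potential f (q t) p) x‖ ^ 2)
          (FDivFlow.riemVol n M) ∧
        HasDerivWithinAt (fun s ↦ FDivFlow.fDiv (FDivFlow.riemVol n M) f (q s) p)
          (-∫ x, q t x * ‖FDivFlow.grad (n := n) (FDivFlow.potential f (q t) p) x‖ ^ 2
            ∂(FDivFlow.riemVol n M)) (Ici 0) t ∧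
        -∫ x, q t x * ‖FDivFlow.grad (n := n) (FDivFlow.potential f (q t) p) x‖ ^ 2
            ∂(FDivFlow.riemVol n M) ≤ 0) := by
  refine ⟨fun d p q hp hp0 hq hint htail hbd t ht ↦ ?_,
    fun n M _ _ _ _ _ _ _ _ _ p q hp hp0 hq t ht ↦ ?_⟩
  · obtain ⟨h1, h2⟩ := hq.hasDerivWithinAt_fDiv hf' hp hp0 hint htail ht (hbd t ht)
    exact ⟨h1, h2, neg_nonpos.2 (integral_nonneg fun x ↦
      mul_nonneg (hq.pos t ht x).le (sq_nonneg _))⟩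
  · obtain ⟨h1, h2, h3⟩ := hq.hasDerivWithinAt_fDiv hf' hp.continuous hp0 ht
    exact ⟨h1, h2, h3, neg_nonpos.2 (integral_nonneg fun x ↦
      mul_nonneg (hq.pos t ht x).le (sq_nonneg _))⟩
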